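/- For $x\in(0,1]$ let $x=\sum_{k\ge1}\frac{1}{d_k\prod_{j=1}^{k-1}d_j(d_j-1)}$, with integers $d_k=d_k(x)\ge2$, be its Lüroth expansion; its digits are uniquely determined by $d_n(x)=\lfloor 1/T^{n-1}(x)\rfloor+1$, where $T(x)=\lfloor 1/x\rfloor\left(\lfloor 1/x+1\rfloor x-1\right)$. For $n\ge1$ put $$Q_n(x)=d_n\prod_{j=1}^{n-1}d_j(d_j-1),\qquad \frac{P_n(x)}{Q_n(x)}=\sum_{k=1}^{n}\frac{1}{d_k\prod_{j=1}^{k-1}d_j(d_j-1)}.$$ Let $\mathbb N=\{1,2,\dots\}$, let $\psi:\mathbb N\to(0,1]$ be arbitrary, and let $L(\psi)$ be the set of all $x\in(0,1]$ such that $\left|x-\frac{P_n(x)}{Q_n(x)}\right|<\frac{\psi(Q_n(x))}{Q_n(x)}$ for infinitely many $n$. For $k\ge1$ let $$S_k=\Big\{d_k\prod_{j=1}^{k-1}d_j(d_j-1): d_1,\dots,d_k\in\mathbb N\setminus\{1\}\Big\}\subset\mathbb N,$$ and define, as elements of $[0,\infty]$, $$\underline\lambda_\psi=\liminf_{k\to\infty}\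 \liminf_{\substack{q\to\infty\\ q\in S_k}}\frac{-\log\psi(q)}{\log q},\qquad \overline\lambda_\psi=\liminf_{k\to\infty}\ \limsup_{\substack{q\to\infty\\ q\in S_k}}\frac{-\log\psi(q)}{\log q},$$ $$\underline\tau_\psi=\liminf_{q\to\infty}\frac{-\log\psi(q)}{\log q},\qquad \overline\tau_\psi=\limsup_{q\to\infty}\frac{-\log\psi(q)}{\log q}.$$ Then, with $\dim$ the Hausdorff dimension and the convention $1/\infty=0$, $$\frac{1}{1+\overline\lambda_\psi}\le\dim L(\psi)\le\frac{1}{1+\underline\lambda_\psi},$$ and moreover $\underline\lambda_\psi\ge\underline\tau_\psi$ and $\overline\lambda_\psi\le\overline\tau_\psi$. -/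

import Mathlib

open Filter Set
open scoped ENNReal Topology

noncomputable section

namespace Luroth

/-- The Lüroth map `T : (0,1] → (0,1]`, `T x = ⌊1/x⌋ (⌊1/x + 1⌋ x - 1)`. -/
def lurothMap (x : ℝ) : ℝ := (⌊1 / x⌋₊ : ℝ) * ((⌊1 / x + 1⌋₊ : ℝ) * x - 1)

/-- The `n`-th Lüroth digit `d_n(x) = ⌊1 / T^{n-1} x⌋ + 1` of `x ∈ (0,1]`, for `n ≥ 1`
(index `0` is never used). -/
def digit (x : ℝ) (n : ℕ) : ℕ := ⌊1 / (lurothMap^[n - 1] x)⌋₊ + 1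

/-- `d_n ∏_{1 ≤ j < n} d_j (d_j - 1)`, for a sequence of digits `d_1, d_2, …`, all at least `2`. -/
def denom (d : ℕ → ℕ) (n : ℕ) : ℕ := d n * ∏ j ∈ Finset.Ico 1 n, d j * (d j - 1)

/-- `[d_1, …, d_n] = ∑_{k=1}^n 1 / (d_k ∏_{1 ≤ j < k} d_j (d_j - 1))`. -/
def convergent (d : ℕ → ℕ) (n : ℕ) : ℝ := ∑ k ∈ Finset.Icc 1 n, 1 / (denom d k : ℝ)

/-- The unsimplified denominator `Q_n(x)` of the `n`-th Lüroth convergent of `x`. -/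
def Q (n : ℕ) (x : ℝ) : ℕ := denom (digit x) n

/-- The unsimplified numerator `P_n(x) = [d_1(x), …, d_n(x)] Q_n(x)`. -/
def P (n : ℕ) (x : ℝ) : ℝ := convergent (digit x) n * (Q n x : ℝ)

/-- The set `L(ψ)` of Lüroth `ψ`-well approximable numbers (a limsup of sets). -/
def L (ψ : ℕ → ℝ) : Set ℝ :=
  limsup (fun n : ℕ =>
    {x : ℝ | x ∈ Ioc (0 : ℝ) 1 ∧ |x - P n x / (Q n x : ℝ)| < ψ (Q n x) / (Q n x : ℝ)}) atTop

/-- The set `S_k`, `k ≥ 1`, of all possible Lüroth denominators at level `k`. -/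
def S (k : ℕ) : Set ℕ := {q | ∃ d : ℕ → ℕ, (∀ n, 2 ≤ d n) ∧ q = denom d k}

/-- The quotient `- log ψ(q) / log q`, as an element of `[0,∞]`. If `0 < ψ(q) ≤ 1` and `q ≥ 2`, it
is nonnegative, so that nothing is truncated. -/
def ratio (ψ : ℕ → ℝ) (q : ℕ) : ℝ≥0∞ := ENNReal.ofReal (-Real.log (ψ q) / Real.log q)

/-- The lower order at infinity of `1/ψ`. -/
def lowerTau (ψ : ℕ → ℝ) : ℝ≥0∞ := liminf (ratio ψ) atTop

/-- The upper order at infinity of `1/ψ`. -/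
def upperTau (ψ : ℕ → ℝ) : ℝ≥0∞ := limsup (ratio ψ) atTop

/-- `liminf_{k → ∞} liminf_{q → ∞, q ∈ S_k} (- log ψ(q) / log q)`. -/
def lowerLambda (ψ : ℕ → ℝ) : ℝ≥0∞ :=
  liminf (fun k : ℕ => liminf (ratio ψ) (atTop ⊓ 𝓟 (S k))) atTop

/-- `liminf_{k → ∞} limsup_{q → ∞, q ∈ S_k} (- log ψ(q) / log q)`. -/
def upperLambda (ψ : ℕ → ℝ) : ℝ≥0∞ :=
  liminf (fun k : ℕ => limsup (ratio ψ) (atTop ⊓ 𝓟 (S k))) atTop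

/-! The digits defined through the Lüroth map are those of the Lüroth expansion: for `x ∈ (0,1]`
they are at least `2` and the convergents converge to `x`. -/

theorem one_le_floor {x : ℝ} (hx : x ∈ Ioc (0 : ℝ) 1) : 1 ≤ ⌊1 / x⌋₊ := by
  apply Nat.le_floor
  rw [le_div_iff₀ hx.1]
  simpa using hx.2

theorem lurothMap_mem {x : ℝ} (hx : x ∈ Ioc (0 : ℝ) 1) : lurothMap x ∈ Ioc (0 : ℝ) 1 := by
  have h0 := hx.1
  have hinv : 0 ≤ 1 / x := by positivity
  have h1 : (1 : ℝ) ≤ (⌊1 / x⌋₊ : ℝ) := by exact_mod_cast one_le_floor hx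
  have h2 : (⌊1 / x⌋₊ : ℝ) * x ≤ 1 := by
    have := Nat.floor_le hinv
    rwa [le_div_iff₀ h0] at this
  have h3 : 1 < ((⌊1 / x⌋₊ : ℝ) + 1) * x := by
    have := Nat.lt_floor_add_one (1 / x)
    rwa [div_lt_iff₀ h0] at this
  unfold lurothMap
  rw [Nat.floor_add_one hinv]
  push_cast
  constructor
  · apply mul_pos <;> linarith
  · nlinarith

theorem iterate_mem {x : ℝ} (hx : x ∈ Ioc (0 : ℝ) 1) (n : ℕ) :
    lurothMap^[n] x ∈ Ioc (0 : ℝ) 1 := by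
  induction n with
  | zero => exact hx
  | succ n ih => rw [Function.iterate_succ_apply']; exact lurothMap_mem ih

theorem two_le_digit {x : ℝ} (hx : x ∈ Ioc (0 : ℝ) 1) (n : ℕ) : 2 ≤ digit x n :=
  Nat.succ_le_succ (one_le_floor (iterate_mem hx (n - 1)))

theorem sub_convergent {x : ℝ} (hx : x ∈ Ioc (0 : ℝ) 1) (n : ℕ) :
    (x - convergent (digit x) n) * (∏ j ∈ Finset.Ico 1 (n + 1), digit x j * (digit x j - 1) : ℕ)
      = lurothMap^[n] x := by
  induction n with
  | zero => simp [convergent]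
  | succ n ih =>
    have hy := iterate_mem hx n
    have hfl := one_le_floor hy
    have hd : digit x (n + 1) = ⌊1 / lurothMap^[n] x⌋₊ + 1 := by simp [digit]
    have hpos : (0 : ℝ) <
        (∏ j ∈ Finset.Ico 1 (n + 1), digit x j * (digit x j - 1) : ℕ) := by
      have : 0 < ∏ j ∈ Finset.Ico 1 (n + 1), digit x j * (digit x j - 1) := by
        refine Finset.prod_pos fun j _ => ?_
        have := two_le_digit hx j
        exact Nat.mul_pos (by omega) (by omega)
      exact_mod_cast this
    rw [Function.iterate_succ_apply', Finset.prod_Ico_succ_top (by omega), convergent,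
      Finset.sum_Icc_succ_top (by omega)]
    change (x - (convergent (digit x) n + _)) * _ = _
    rw [denom, hd, lurothMap, Nat.floor_add_one (by have := hy.1; positivity)]
    rw [Nat.add_sub_cancel]
    generalize hm : ⌊1 / lurothMap^[n] x⌋₊ = m at *
    generalize hp : (∏ j ∈ Finset.Ico 1 (n + 1), digit x j * (digit x j - 1)) = p at *
    rw [← ih]
    push_cast
    have hm1 : (0 : ℝ) < (m : ℝ) + 1 := by positivity
    field_simp
    ring

theorem tendsto_convergent {x : ℝ} (hx : x ∈ Ioc (0 : ℝ) 1) :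
    Tendsto (convergent (digit x)) atTop (𝓝 x) := by
  rw [tendsto_iff_dist_tendsto_zero]
  refine squeeze_zero (fun _ => dist_nonneg) (fun n => ?_)
    (tendsto_pow_atTop_nhds_zero_of_lt_one (r := (1 / 2 : ℝ)) (by norm_num) (by norm_num))
  have h := sub_convergent hx n
  have hy := iterate_mem hx n
  have hp : (2 : ℝ) ^ n ≤ (∏ j ∈ Finset.Ico 1 (n + 1), digit x j * (digit x j - 1) : ℕ) := by
    have : 2 ^ n ≤ ∏ j ∈ Finset.Ico 1 (n + 1), digit x j * (digit x j - 1) := by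
      calc 2 ^ n = ∏ j ∈ Finset.Ico 1 (n + 1), 2 := by simp
        _ ≤ _ := by
          refine Finset.prod_le_prod' fun j _ => ?_
          have := two_le_digit hx j
          calc 2 = 2 * 1 := rfl
            _ ≤ _ := Nat.mul_le_mul this (by omega)
    exact_mod_cast this
  have h2 : (0 : ℝ) < 2 ^ n := by positivity
  rw [← h] at hy
  have hnn : 0 < x - convergent (digit x) n := by
    by_contra hc
    have := mul_nonpos_of_nonpos_of_nonneg (not_lt.mp hc) (h2.le.trans hp)
    linarith [hy.1]
  rw [dist_comm, Real.dist_eq, abs_of_pos hnn, one_div, inv_pow, ← one_div, le_div_iff₀ h2]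
  exact (mul_le_mul_of_nonneg_left hp hnn.le).trans hy.2

end Luroth

end

/-! Everything is sandwiched between the sets `wellApprox s`, of dimension 1/(1+s) for s > 0. The
sets S_k decrease with k, and for every x the denominators Q_n(x) tend to infinity inside each S_k.
Hence L(ψ) ⊆ `wellApprox s` for s below `lowerLambda ψ`, and the reverse inclusion holds for s above
`upperLambda ψ`.

Upper bound (`dimH_wellApprox_le`): points with the same first n digits share their n-th convergent,
so good approximation confines them to a set of diameter at most 2 Q_n^{-(1+s)}. For u = (1+s)t > 1
the sum of Q_n^{-u} over words factors as Σ d^{-u} times a power of Σ (d(d-1))^{-u}. The latter is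
less than 1, because Σ 1/(d(d-1)) = 1, so the covering sums are dominated by a geometric series.

Lower bound (`le_dimH_wellApprox`): x - P_n/Q_n is the length of the n-th cylinder times T^n x. If
d_n = 2, then Q_n is the inverse of that length, so a next digit of order Q_n^s gives the required
approximation. A Cantor set is built from free blocks (`exists_words`: almost full dimension) and
single large digits ranging over m, ..., 2m-1. A large digit is inserted once the number M of words
and the lower bound ρ for their lengths satisfy M ≥ ρ^{-τ}, where τ = (1+s)t < 1. Its m choices are
spread evenly, so the inverse of the coding map is t-Hölder (`le_dimH_of_mixed_radix`). -/

namespace Luroth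

/-! ### Inverse branches, cylinders and their separation -/

/-- The inverse branch of the Lüroth map on the points with first digit `d`. -/
noncomputable def branch (d : ℕ) (u : ℝ) : ℝ := 1 / d + u / (d * (d - 1))

theorem branch_sub (d : ℕ) (u v : ℝ) :
    branch d u - branch d v = ((d : ℝ) * (d - 1))⁻¹ * (u - v) := by
  unfold branch; ring

theorem branch_one {d : ℕ} (hd : 2 ≤ d) : branch d 1 = 1 / ((d : ℝ) - 1) := by
  have h : (2 : ℝ) ≤ d := by exact_mod_cast hd
  have h1 : (d : ℝ) - 1 ≠ 0 := by linarith
  unfold branch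
  field_simp
  ring

theorem branch_mono {d : ℕ} (hd : 2 ≤ d) {u v : ℝ} (h : u ≤ v) : branch d u ≤ branch d v := by
  have h2 : (2 : ℝ) ≤ d := by exact_mod_cast hd
  have h1 : 0 < (d : ℝ) * (d - 1) := by nlinarith
  have := mul_nonneg (inv_pos.2 h1).le (sub_nonneg.2 h)
  rw [← branch_sub] at this
  linarith

theorem branch_mem_Icc {d : ℕ} (hd : 2 ≤ d) {u : ℝ} (hu : u ∈ Icc (0 : ℝ) 1) :
    branch d u ∈ Icc (1 / (d : ℝ)) (1 / ((d : ℝ) - 1)) := by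
  constructor
  · have := branch_mono hd hu.1
    simpa [branch] using this
  · rw [← branch_one hd]
    exact branch_mono hd hu.2

theorem lt_branch {d : ℕ} (hd : 2 ≤ d) {u : ℝ} (hu : 0 < u) : 1 / (d : ℝ) < branch d u := by
  have h : (2 : ℝ) ≤ d := by exact_mod_cast hd
  have h1 : 0 < (d : ℝ) * (d - 1) := by nlinarith
  have : 0 < u / ((d : ℝ) * (d - 1)) := by positivity
  unfold branch
  linarith

theorem branch_mem_Ioc {d : ℕ} (hd : 2 ≤ d) {u : ℝ} (hu : u ∈ Icc (0 : ℝ) 1) :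
    branch d u ∈ Ioc (0 : ℝ) 1 := by
  have h : (2 : ℝ) ≤ d := by exact_mod_cast hd
  obtain ⟨h1, h2⟩ := branch_mem_Icc hd hu
  refine ⟨lt_of_lt_of_le (by positivity) h1, h2.trans ?_⟩
  rw [div_le_one (by linarith)]
  linarith

theorem floor_branch {d : ℕ} (hd : 2 ≤ d) {u : ℝ} (hu : u ∈ Ioc (0 : ℝ) 1) :
    ⌊1 / branch d u⌋₊ = d - 1 := by
  have h : (2 : ℝ) ≤ d := by exact_mod_cast hd
  have hpos := (branch_mem_Ioc hd (Ioc_subset_Icc_self hu)).1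
  have h1 := (branch_mem_Icc hd (Ioc_subset_Icc_self hu)).2
  have h2 := lt_branch hd hu.1
  rw [Nat.floor_eq_iff (by positivity), Nat.cast_sub (by omega), Nat.cast_one]
  rw [le_div_iff₀ (by linarith)] at h1
  rw [div_lt_iff₀ (by linarith)] at h2
  constructor
  · rw [le_div_iff₀ hpos]; linarith
  · rw [div_lt_iff₀ hpos]; linarith

theorem lurothMap_branch {d : ℕ} (hd : 2 ≤ d) {u : ℝ} (hu : u ∈ Ioc (0 : ℝ) 1) :
    lurothMap (branch d u) = u := by
  have h : (2 : ℝ) ≤ d := by exact_mod_cast hd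
  have hpos := (branch_mem_Ioc hd (Ioc_subset_Icc_self hu)).1
  have h1 : (d : ℝ) - 1 ≠ 0 := by linarith
  rw [lurothMap, Nat.floor_add_one (by positivity), floor_branch hd hu, Nat.sub_add_cancel (by omega),
    Nat.cast_sub (by omega), branch]
  field_simp
  push_cast
  ring

/-- The point whose Lüroth expansion starts with the word `w`, followed by that of `u`. -/
noncomputable def cylMap (w : List ℕ) (u : ℝ) : ℝ := w.foldr branch u

/-- The length of the cylinder of a word. -/
noncomputable def cylLen (w : List ℕ) : ℝ := (w.map fun d : ℕ => ((d : ℝ) * (d - 1))⁻¹).prod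

@[simp] theorem cylMap_nil (u : ℝ) : cylMap [] u = u := rfl

@[simp] theorem cylMap_cons (d : ℕ) (w : List ℕ) (u : ℝ) :
    cylMap (d :: w) u = branch d (cylMap w u) := rfl

theorem cylMap_append (v w : List ℕ) (u : ℝ) : cylMap (v ++ w) u = cylMap v (cylMap w u) := by
  simp [cylMap]

@[simp] theorem cylLen_nil : cylLen [] = 1 := rfl

@[simp] theorem cylLen_cons (d : ℕ) (w : List ℕ) :
    cylLen (d :: w) = ((d : ℝ) * (d - 1))⁻¹ * cylLen w := by simp [cylLen]

theorem cylLen_append (v w : List ℕ) : cylLen (v ++ w) = cylLen v * cylLen w := by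
  simp [cylLen]

theorem cylMap_sub (w : List ℕ) (u v : ℝ) : cylMap w u - cylMap w v = cylLen w * (u - v) := by
  induction w with
  | nil => simp
  | cons d w ih => rw [cylMap_cons, cylMap_cons, branch_sub, ih, cylLen_cons, mul_assoc]

theorem cylLen_pos {w : List ℕ} (hw : ∀ d ∈ w, 2 ≤ d) : 0 < cylLen w := by
  induction w with
  | nil => simp
  | cons d w ih =>
    have h : (2 : ℝ) ≤ d := by exact_mod_cast hw d (by simp)
    have h1 : 0 < (d : ℝ) * (d - 1) := by nlinarith
    have := ih fun e he => hw e (by simp [he])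
    rw [cylLen_cons]
    positivity

theorem cylMap_mem_Icc {w : List ℕ} (hw : ∀ d ∈ w, 2 ≤ d) {u : ℝ} (hu : u ∈ Icc (0 : ℝ) 1) :
    cylMap w u ∈ Icc (0 : ℝ) 1 := by
  induction w with
  | nil => simpa
  | cons d w ih =>
    exact Ioc_subset_Icc_self
      (branch_mem_Ioc (hw d (by simp)) (ih fun e he => hw e (by simp [he])))

theorem cylMap_mem_Ioc {w : List ℕ} (hw : ∀ d ∈ w, 2 ≤ d) {u : ℝ} (hu : u ∈ Ioc (0 : ℝ) 1) :
    cylMap w u ∈ Ioc (0 : ℝ) 1 := by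
  cases w with
  | nil => simpa
  | cons d w =>
    exact branch_mem_Ioc (hw d (by simp))
      (cylMap_mem_Icc (fun e he => hw e (by simp [he])) (Ioc_subset_Icc_self hu))

theorem iterate_cylMap {w : List ℕ} (hw : ∀ d ∈ w, 2 ≤ d) {u : ℝ} (hu : u ∈ Ioc (0 : ℝ) 1) :
    lurothMap^[w.length] (cylMap w u) = u := by
  induction w with
  | nil => simp
  | cons d w ih =>
    have hw' : ∀ e ∈ w, 2 ≤ e := fun e he => hw e (by simp [he])
    rw [List.length_cons, Function.iterate_succ_apply, cylMap_cons,
      lurothMap_branch (hw d (by simp)) (cylMap_mem_Ioc hw' hu), ih hw']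

theorem digit_cylMap_append {w : List ℕ} (hw : ∀ d ∈ w, 2 ≤ d) {d : ℕ} (hd : 2 ≤ d) {u : ℝ}
    (hu : u ∈ Ioc (0 : ℝ) 1) : digit (cylMap (w ++ [d]) u) (w.length + 1) = d := by
  have h := branch_mem_Ioc hd (Ioc_subset_Icc_self hu)
  rw [digit, Nat.add_sub_cancel, cylMap_append, iterate_cylMap hw (by simpa using h)]
  rw [cylMap_cons, cylMap_nil, floor_branch hd hu]
  omega

theorem prod_digit_cylMap {w : List ℕ} (hw : ∀ d ∈ w, 2 ≤ d) {u : ℝ} (hu : u ∈ Ioc (0 : ℝ) 1) :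
    ((∏ j ∈ Finset.Ico 1 (w.length + 1),
      digit (cylMap w u) j * (digit (cylMap w u) j - 1) : ℕ) : ℝ) = (cylLen w)⁻¹ := by
  induction w using List.reverseRecOn generalizing u with
  | nil => simp
  | append_singleton w d ih =>
    have hw' : ∀ e ∈ w, 2 ≤ e := fun e he => hw e (by simp [he])
    have hd : 2 ≤ d := hw d (by simp)
    have hb := branch_mem_Ioc hd (Ioc_subset_Icc_self hu)
    rw [List.length_append, List.length_singleton, Finset.prod_Ico_succ_top (by omega),
      digit_cylMap_append hw' hd hu, Nat.cast_mul, cylMap_append, cylMap_cons, cylMap_nil, ih hw' hb,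
      cylLen_append, cylLen_cons, cylLen_nil, Nat.cast_mul, Nat.cast_sub (by omega)]
    simp [mul_comm]

theorem branch_inj {d e : ℕ} (hd : 2 ≤ d) (he : 2 ≤ e) {u v : ℝ} (hu : u ∈ Ioc (0 : ℝ) 1)
    (hv : v ∈ Ioc (0 : ℝ) 1) (h : branch d u = branch e v) : d = e ∧ u = v := by
  constructor
  · have h1 := floor_branch hd hu
    rw [h, floor_branch he hv] at h1
    omega
  · rw [← lurothMap_branch hd hu, h, lurothMap_branch he hv]

theorem cylMap_inj {v w : List ℕ} (hl : v.length = w.length) (hv : ∀ d ∈ v, 2 ≤ d)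
    (hw : ∀ d ∈ w, 2 ≤ d) {a b : ℝ} (ha : a ∈ Ioc (0 : ℝ) 1) (hb : b ∈ Ioc (0 : ℝ) 1)
    (h : cylMap v a = cylMap w b) : v = w := by
  induction v generalizing w with
  | nil => simpa [eq_comm] using hl
  | cons d v ih =>
    cases w with
    | nil => simp at hl
    | cons e w =>
      have hv' : ∀ e ∈ v, 2 ≤ e := fun e he => hv e (by simp [he])
      have hw' : ∀ e ∈ w, 2 ≤ e := fun e he => hw e (by simp [he])
      obtain ⟨h1, h2⟩ := branch_inj (hv d (by simp)) (hw e (by simp))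
        (cylMap_mem_Ioc hv' ha) (cylMap_mem_Ioc hw' hb) h
      rw [h1, ih (by simpa using hl) hv' hw' h2]

/-- Points in the upper halves of disjoint cylinders are separated. -/
theorem separation_of_ne {v w : List ℕ} (hl : v.length = w.length) (hne : v ≠ w)
    (hv : ∀ d ∈ v, 2 ≤ d) (hw : ∀ d ∈ w, 2 ≤ d) {a b ε : ℝ} (ha : a ∈ Icc (1 / 2 : ℝ) 1)
    (hb : b ∈ Icc (1 / 2 : ℝ) 1) (hεv : ε ≤ cylLen v) (hεw : ε ≤ cylLen w) :
    ε / 2 ≤ |cylMap v a - cylMap w b| := by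
  wlog hab : cylMap v a ≤ cylMap w b generalizing v w a b
  · rw [abs_sub_comm]
    exact this hl.symm hne.symm hw hv hb ha hεw hεv (not_le.1 hab).le
  have hpv := cylLen_pos hv
  have hpw := cylLen_pos hw
  -- The half-open cylinders of distinct words of equal length are disjoint, so the left one ends
  -- before the right one begins. The lower half of the right one then separates the two points.
  have key : cylMap v 1 ≤ cylMap w 0 := by
    by_contra hc
    push Not at hc
    have e1 := cylMap_sub v a 1
    have e2 := cylMap_sub w b 0
    obtain ⟨y, hy, z, hz, hyz⟩ : ∃ y ∈ Ioc (0 : ℝ) 1, ∃ z ∈ Ioc (0 : ℝ) 1,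
        cylMap v y = cylMap w z := by
      by_cases h1 : cylMap v 1 ≤ cylMap w 1
      · have e3 := cylMap_sub w 1 0
        refine ⟨1, by simp, (cylMap v 1 - cylMap w 0) / cylLen w, ⟨?_, ?_⟩, ?_⟩
        · exact div_pos (by linarith) hpw
        · rw [div_le_one hpw]; linarith
        · have := cylMap_sub w ((cylMap v 1 - cylMap w 0) / cylLen w) 0
          rw [sub_zero, mul_div_cancel₀ _ hpw.ne'] at this
          linarith
      · push Not at h1
        have e3 := cylMap_sub v a 0
        have e4 := cylMap_sub v 1 0
        have e5 := cylMap_sub w b 1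
        have : 0 < cylLen v * (a - 0) := mul_pos hpv (by linarith [ha.1])
        have : cylLen w * (b - 1) ≤ 0 := mul_nonpos_of_nonneg_of_nonpos hpw.le (by linarith [hb.2])
        refine ⟨(cylMap w b - cylMap v 0) / cylLen v, ⟨?_, ?_⟩, b,
          ⟨by linarith [hb.1], hb.2⟩, ?_⟩
        · exact div_pos (by linarith) hpv
        · rw [div_le_one hpv]; linarith
        · have := cylMap_sub v ((cylMap w b - cylMap v 0) / cylLen v) 0
          rw [sub_zero, mul_div_cancel₀ _ hpv.ne'] at this
          linarith
    exact hne (cylMap_inj hl hv hw hy hz hyz)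
  have e1 := cylMap_sub v a 1
  have e2 := cylMap_sub w b 0
  have h1 : cylLen v * (a - 1) ≤ 0 :=
    mul_nonpos_of_nonneg_of_nonpos hpv.le (by linarith [ha.2])
  have h2 : cylLen w * (1 / 2) ≤ cylLen w * (b - 0) :=
    mul_le_mul_of_nonneg_left (by linarith [hb.1]) hpw.le
  rw [abs_sub_comm, abs_of_nonneg (by linarith)]
  linarith

/-- Points in the upper halves of two cylinders of order one. -/
theorem separation_branch {N i j : ℕ} (hN : 2 ≤ N) (hi : i < N) (hj : j < N) (hij : i ≠ j)
    {a b : ℝ} (ha : a ∈ Icc (1 / 2 : ℝ) 1) (hb : b ∈ Icc (1 / 2 : ℝ) 1) :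
    1 / (8 * (N : ℝ) ^ 2) * |(i : ℝ) - j| ≤ |branch (N + i) a - branch (N + j) b| := by
  wlog h : i < j generalizing i j a b
  · rw [abs_sub_comm (i : ℝ), abs_sub_comm (branch _ _)]
    exact this hj hi hij.symm hb ha (by omega)
  have hN' : (2 : ℝ) ≤ N := by exact_mod_cast hN
  have hij' : (i : ℝ) + 1 ≤ j := by exact_mod_cast h
  have hj' : (j : ℝ) + 1 ≤ N := by exact_mod_cast hj
  have hi0 : (0 : ℝ) ≤ i := by positivity
  have h1 := (branch_mem_Icc (d := N + j) (by omega) ⟨by linarith [hb.1], hb.2⟩).2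
  have h2 : branch (N + i) (1 / 2) ≤ branch (N + i) a := branch_mono (by omega) ha.1
  -- Larger digits lie nearer 0. The gap consists of the cylinders strictly between and the lower
  -- half of that of N + i; the bound D, D' ≤ 2N gives the constant 8.
  have h3 : 1 / (8 * (N : ℝ) ^ 2) * (j - i) ≤
      branch (N + i) (1 / 2) - 1 / (((N + j : ℕ) : ℝ) - 1) := by
    unfold branch
    push_cast
    set D : ℝ := (N : ℝ) + i with hD
    set D' : ℝ := (N : ℝ) + j - 1 with hD'
    have hDD : D ≤ D' := by linarith
    have hD2 : 2 ≤ D := by linarith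
    have hD0 : 0 < D := by linarith
    have hD0' : 0 < D' := by linarith
    have e : (j : ℝ) - i = D' - D + 1 := by rw [hD, hD']; ring
    rw [e]
    have s1 : 1 / (2 * (D * D')) ≤ 1 / 2 / (D * (D - 1)) := by
      rw [div_div]
      apply one_div_le_one_div_of_le
      · nlinarith
      · nlinarith
    have s2 : 1 / D - 1 / D' = (D' - D) / (D * D') := by
      rw [div_sub_div _ _ hD0.ne' hD0'.ne', one_mul, mul_one]
    have s3 : 1 / (8 * (N : ℝ) ^ 2) * (D' - D + 1) ≤ (D' - D + 1) / (2 * (D * D')) := by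
      rw [one_div_mul_eq_div]
      apply div_le_div_of_nonneg_left
      · linarith
      · positivity
      · have : D * D' ≤ (2 * N) * (2 * N) := by
          apply mul_le_mul <;> linarith
        linarith
    have s4 : (D' - D + 1) / (2 * (D * D')) ≤ (D' - D) / (D * D') + 1 / (2 * (D * D')) := by
      have : 0 ≤ (D' - D) / (D * D') := by
        apply div_nonneg; linarith; positivity
      have e2 : (D' - D + 1) / (2 * (D * D')) = (D' - D) / (D * D') / 2 + 1 / (2 * (D * D')) := by
        field_simp
      rw [e2]; linarith
    linarith
  have h4 : 0 ≤ 1 / (8 * (N : ℝ) ^ 2) * (j - i) := by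
    apply mul_nonneg (by positivity); linarith
  rw [abs_sub_comm, abs_of_nonneg (by linarith : (0 : ℝ) ≤ (j : ℝ) - i), abs_of_nonneg (by linarith)]
  linarith

/-! ### Many words with cylinders of comparable length -/

theorem sum_inv_mul_pred {M : ℕ} (hM : 1 ≤ M) :
    ∑ d ∈ Finset.Icc 2 M, ((d : ℝ) * (d - 1))⁻¹ = 1 - 1 / M := by
  induction M, hM using Nat.le_induction with
  | base => simp
  | succ M hM ih =>
    have : (1 : ℝ) ≤ M := by exact_mod_cast hM
    rw [Finset.sum_Icc_succ_top (by omega), ih]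
    push_cast
    have h1 : (M : ℝ) ≠ 0 := by linarith
    have h2 : (M : ℝ) + 1 ≠ 0 := by linarith
    rw [add_sub_cancel_right]
    field_simp
    ring

theorem cylLen_ofFn {n : ℕ} (f : Fin n → ℕ) :
    cylLen (List.ofFn f) = ∏ i, ((f i : ℝ) * (f i - 1))⁻¹ := by
  rw [cylLen, List.map_ofFn, List.prod_ofFn]
  rfl

/-- For every exponent `σ < 1` there are many words of the same length, all of whose cylinders have
length at least `2 * r`, the number of words being at least `r ^ (-σ)`. -/
theorem exists_words {σ : ℝ} (hσ0 : 0 < σ) (hσ : σ < 1) :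
    ∃ (m : ℕ) (r : ℝ) (n : ℕ) (W : ℕ → List ℕ), 0 < r ∧ r < 1 ∧ 1 ≤ m * r ^ σ ∧
      (∀ i < m, (W i).length = n ∧ (∀ d ∈ W i, 2 ≤ d) ∧ 2 * r ≤ cylLen (W i)) ∧
      ∀ i < m, ∀ j < m, i ≠ j → W i ≠ W j := by
  have hκ : (1 : ℝ) < 2 ^ (1 - σ) := Real.one_lt_rpow (by norm_num) (by linarith)
  -- Restricting a digit to 2, ..., M keeps the proportion 1 - 1/M of the length, while each digit
  -- at least halves a cylinder, which gains 2^(1-σ) in the count. The net factor c must exceed 1.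
  obtain ⟨M, hM, hc⟩ : ∃ M : ℕ, 2 ≤ M ∧ 1 < (1 - 1 / (M : ℝ)) * 2 ^ (1 - σ) := by
    have h1 : Tendsto (fun M : ℕ => (1 - 1 / (M : ℝ)) * 2 ^ (1 - σ)) atTop
        (𝓝 ((1 - 0) * 2 ^ (1 - σ))) :=
      (tendsto_const_nhds.sub tendsto_one_div_atTop_nhds_zero_nat).mul_const _
    rw [sub_zero, one_mul] at h1
    exact ((eventually_ge_atTop 2).and (h1.eventually_const_lt hκ)).exists
  obtain ⟨ℓ, hℓ⟩ : ∃ ℓ : ℕ, M ≤ 2 ^ ℓ := ⟨M, Nat.lt_two_pow_self.le⟩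
  set c : ℝ := (1 - 1 / (M : ℝ)) * 2 ^ (1 - σ) with hcdef
  -- There will be 2ℓn + 1 dyadic classes of lengths; the 4 pays for taking r = 2^(-(j+2)) instead
  -- of 2^(-j).
  obtain ⟨n, hn⟩ : ∃ n : ℕ, 4 * (2 * ℓ * n + 1 : ℝ) ≤ c ^ n := by
    have h1 : Tendsto (fun n : ℕ => ((8 * ℓ : ℝ) * ((n : ℝ) ^ 1 / c ^ n)) + 4 * (c⁻¹) ^ n) atTop
        (𝓝 ((8 * ℓ : ℝ) * 0 + 4 * 0)) :=
      ((tendsto_pow_const_div_const_pow_of_one_lt 1 hc).const_mul _).add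
        ((tendsto_pow_atTop_nhds_zero_of_lt_one (by positivity) (inv_lt_one_of_one_lt₀ hc)).const_mul _)
    simp only [mul_zero, add_zero] at h1
    obtain ⟨n, hn⟩ := (h1.eventually_le_const (show (0 : ℝ) < 1 by norm_num)).exists
    refine ⟨n, ?_⟩
    have hcn : 0 < c ^ n := by positivity
    rw [pow_one, inv_pow] at hn
    calc 4 * (2 * ℓ * n + 1 : ℝ) = (8 * ℓ * (n / c ^ n) + 4 * (c ^ n)⁻¹) * c ^ n := by
          field_simp; ring
      _ ≤ 1 * c ^ n := by gcongr
      _ = c ^ n := one_mul _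
  have hM0 : 0 < 1 - 1 / (M : ℝ) := by
    have : (2 : ℝ) ≤ M := by exact_mod_cast hM
    rw [sub_pos, div_lt_one (by linarith)]; linarith
  set F : Finset (Fin n → ℕ) := Fintype.piFinset fun _ => Finset.Icc 2 M with hF
  have hmem : ∀ f ∈ F, ∀ i, 2 ≤ f i ∧ f i ≤ M := fun f hf i => by
    simpa using Fintype.mem_piFinset.1 hf i
  let p : (Fin n → ℕ) → ℕ := fun f => ∏ i, f i * (f i - 1)
  have hp : ∀ f ∈ F, cylLen (List.ofFn f) = ((p f : ℕ) : ℝ)⁻¹ := fun f hf => by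
    rw [cylLen_ofFn, Finset.prod_inv_distrib, Nat.cast_prod]
    congr 1
    refine Finset.prod_congr rfl fun i _ => ?_
    rw [Nat.cast_mul, Nat.cast_sub (by have := (hmem f hf i).1; omega), Nat.cast_one]
  have hp1 : ∀ f ∈ F, 2 ^ n ≤ p f := fun f hf => by
    calc 2 ^ n = ∏ i : Fin n, 2 := by simp
      _ ≤ _ := by
        refine Finset.prod_le_prod' fun i _ => ?_
        have := (hmem f hf i).1
        calc 2 = 2 * 1 := rfl
          _ ≤ _ := Nat.mul_le_mul this (by omega)
  have hp2 : ∀ f ∈ F, p f ≤ 2 ^ (2 * ℓ * n) := fun f hf => by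
    calc p f ≤ ∏ i : Fin n, 2 ^ ℓ * 2 ^ ℓ := by
          refine Finset.prod_le_prod' fun i _ => ?_
          have := (hmem f hf i).2
          exact Nat.mul_le_mul (by omega) (by omega)
      _ = _ := by simp [← pow_add, ← pow_mul, two_mul]
  have hsum : ∑ f ∈ F, cylLen (List.ofFn f) = (1 - 1 / (M : ℝ)) ^ n := by
    simp_rw [cylLen_ofFn]
    rw [hF, ← Finset.prod_univ_sum (fun _ : Fin n => Finset.Icc 2 M)
      (fun _ d => ((d : ℝ) * (d - 1))⁻¹), sum_inv_mul_pred (by omega)]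
    simp
  -- Pigeonhole: some class of words with inverse length in [2^j, 2^(j+1)) carries at least the
  -- average share of the total length.
  obtain ⟨j, -, hj⟩ := Finset.exists_le_sum_fiber_of_maps_to_of_nsmul_le_sum (s := F)
    (t := Finset.range (2 * ℓ * n + 1)) (f := fun f => Nat.log 2 (p f))
    (w := fun f => cylLen (List.ofFn f)) (b := (1 - 1 / (M : ℝ)) ^ n / (2 * ℓ * n + 1))
    (fun f hf => by
      rw [Finset.mem_range, Nat.lt_succ_iff]
      exact (Nat.log_mono_right (hp2 f hf)).trans (Nat.log_pow (by norm_num) _).le)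
    (by simp)
    (by
      rw [hsum, Finset.card_range, nsmul_eq_mul]
      push_cast
      rw [mul_div_cancel₀ _ (by positivity)])
  set G : Finset (Fin n → ℕ) := F.filter fun f => Nat.log 2 (p f) = j with hG
  have hGF : ∀ f ∈ G, f ∈ F ∧ Nat.log 2 (p f) = j := fun f hf => Finset.mem_filter.1 hf
  have hpne : ∀ f ∈ F, p f ≠ 0 := fun f hf => by
    have := hp1 f hf
    have : 0 < 2 ^ n := by positivity
    omega
  have hcard : (1 - 1 / (M : ℝ)) ^ n / (2 * ℓ * n + 1) ≤ G.card * ((2 : ℝ) ^ j)⁻¹ := by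
    refine hj.trans ?_
    rw [← nsmul_eq_mul]
    refine Finset.sum_le_card_nsmul _ _ _ fun f hf => ?_
    obtain ⟨h1, h2⟩ := hGF f hf
    rw [hp f h1]
    apply inv_anti₀ (by positivity)
    have := Nat.pow_log_le_self 2 (hpne f h1)
    rw [h2] at this
    exact_mod_cast this
  have hGpos : 0 < G.card := by
    by_contra h0
    have : G.card = 0 := by omega
    rw [this, Nat.cast_zero, zero_mul] at hcard
    have : 0 < (1 - 1 / (M : ℝ)) ^ n / (2 * ℓ * n + 1) := by positivity
    linarith
  have hnj : n ≤ j := by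
    obtain ⟨f, hf⟩ := Finset.card_pos.1 hGpos
    obtain ⟨h1, h2⟩ := hGF f hf
    rw [← h2, ← Nat.log_pow (b := 2) (by norm_num) n]
    exact Nat.log_mono_right (hp1 f h1)
  refine ⟨G.card, ((2 : ℝ) ^ (j + 2))⁻¹, n,
    fun i => if h : i < G.card then List.ofFn (G.equivFin.symm ⟨i, h⟩ : Fin n → ℕ) else [],
    by positivity, ?_, ?_, ?_, ?_⟩
  · apply inv_lt_one_of_one_lt₀
    exact one_lt_pow₀ (by norm_num) (by omega)
  · have h2 : (2 : ℝ) ^ j * ((1 - 1 / (M : ℝ)) ^ n / (2 * ℓ * n + 1)) ≤ G.card := by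
      calc _ ≤ (2 : ℝ) ^ j * (G.card * ((2 : ℝ) ^ j)⁻¹) := by gcongr
        _ = _ := by field_simp
    have h3 : (((2 : ℝ) ^ (j + 2))⁻¹) ^ σ = 2 ^ (-((j + 2 : ℝ) * σ)) := by
      rw [← Real.rpow_natCast, ← Real.rpow_neg (by norm_num), ← Real.rpow_mul (by norm_num)]
      push_cast; ring_nf
    have h4 : c ^ n * (1 / 4) ≤ (1 - 1 / (M : ℝ)) ^ n * (2 ^ j * (2 : ℝ) ^ (-((j + 2 : ℝ) * σ))) := by
      rw [hcdef, mul_pow, mul_assoc]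
      refine mul_le_mul_of_nonneg_left ?_ (by positivity)
      rw [← Real.rpow_natCast _ n, ← Real.rpow_mul (by norm_num), ← Real.rpow_natCast 2 j,
        show (1 / 4 : ℝ) = 2 ^ (-2 : ℝ) by
          rw [Real.rpow_neg (by norm_num)]; norm_num, ← Real.rpow_add (by norm_num),
        ← Real.rpow_add (by norm_num)]
      apply Real.rpow_le_rpow_of_exponent_le (by norm_num)
      have : (n : ℝ) ≤ j := by exact_mod_cast hnj
      nlinarith
    rw [h3]
    calc (1 : ℝ) ≤ c ^ n * (1 / 4) / (2 * ℓ * n + 1) := by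
          rw [le_div_iff₀ (by positivity)]; linarith
      _ ≤ (1 - 1 / (M : ℝ)) ^ n * (2 ^ j * (2 : ℝ) ^ (-((j + 2 : ℝ) * σ))) / (2 * ℓ * n + 1) := by
          gcongr
      _ = (2 : ℝ) ^ j * ((1 - 1 / (M : ℝ)) ^ n / (2 * ℓ * n + 1)) * 2 ^ (-((j + 2 : ℝ) * σ)) := by
          ring
      _ ≤ _ := by gcongr
  · intro i hi
    simp only [dif_pos hi]
    have hf := (G.equivFin.symm ⟨i, hi⟩).2
    obtain ⟨h1, h2⟩ := hGF _ hf
    refine ⟨List.length_ofFn, fun d hd => ?_, ?_⟩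
    · obtain ⟨k, rfl⟩ := List.mem_ofFn.1 hd
      exact (hmem _ h1 k).1
    · rw [hp _ h1]
      have := Nat.lt_pow_succ_log_self (b := 2) (by norm_num) (p (G.equivFin.symm ⟨i, hi⟩ : Fin n → ℕ))
      rw [h2] at this
      have h5 : ((p (G.equivFin.symm ⟨i, hi⟩ : Fin n → ℕ) : ℕ) : ℝ) ≤ 2 ^ (j + 1) := by
        exact_mod_cast this.le
      have h6 : (0 : ℝ) < (p (G.equivFin.symm ⟨i, hi⟩ : Fin n → ℕ) : ℕ) := by
        exact_mod_cast Nat.pos_of_ne_zero (hpne _ h1)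
      calc 2 * ((2 : ℝ) ^ (j + 2))⁻¹ = (2 ^ (j + 1))⁻¹ := by
            rw [pow_succ _ (j + 1)]; field_simp
        _ ≤ _ := inv_anti₀ h6 h5
  · intro i hi k hk hik h
    simp only [dif_pos hi, dif_pos hk] at h
    have := G.equivFin.symm.injective (Subtype.ext (List.ofFn_injective h))
    exact hik (by simpa using this)

end Luroth

/-! ### Upper bound by the natural cover -/

open MeasureTheory

theorem ENNReal.tsum_pi_prod {α : Type*} (b : α → ℝ≥0∞) (k : ℕ) :
    ∑' f : Fin k → α, ∏ i, b (f i) = (∑' a, b a) ^ k := by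
  induction k with
  | zero => simp
  | succ k ih =>
    rw [← (Fin.consEquiv fun _ : Fin (k + 1) => α).tsum_eq, ENNReal.tsum_prod', pow_succ']
    simp only [Fin.consEquiv_apply, Fin.prod_univ_succ, Fin.cons_zero, Fin.cons_succ,
      ENNReal.tsum_mul_left, ENNReal.tsum_mul_right, ih]

namespace Luroth

theorem tsum_inv_mul_succ :
    ∑' i : ℕ, ENNReal.ofReal (((i + 2 : ℝ) * (i + 1))⁻¹) ≤ 1 := by
  rw [ENNReal.tsum_eq_iSup_nat]
  refine iSup_le fun n => ?_
  rw [← ENNReal.ofReal_sum_of_nonneg fun i _ => by positivity]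
  rw [show ∑ i ∈ Finset.range n, ((i + 2 : ℝ) * (i + 1))⁻¹ = 1 - 1 / (n + 1 : ℝ) by
    induction n with
    | zero => simp
    | succ n ih =>
      rw [Finset.sum_range_succ, ih]
      push_cast
      field_simp
      ring]
  rw [← ENNReal.ofReal_one]
  apply ENNReal.ofReal_le_ofReal
  have : 0 ≤ 1 / (n + 1 : ℝ) := by positivity
  linarith

/-- Since d(d-1) ≥ 2, each term is at most 2^(1-u) times the corresponding term of the series for u
= 1, whose sum is at most 1. -/
theorem tsum_rpow_mul_succ_lt_one {u : ℝ} (hu : 1 < u) :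
    ∑' i : ℕ, ENNReal.ofReal (((i + 2 : ℝ) * (i + 1)) ^ (-u)) < 1 := by
  have h : ∀ i : ℕ, ENNReal.ofReal (((i + 2 : ℝ) * (i + 1)) ^ (-u)) ≤
      ENNReal.ofReal (2 ^ (1 - u)) * ENNReal.ofReal (((i + 2 : ℝ) * (i + 1))⁻¹) := fun i => by
    rw [← ENNReal.ofReal_mul (by positivity)]
    apply ENNReal.ofReal_le_ofReal
    have hi : (0 : ℝ) ≤ i := by positivity
    have hp : (0 : ℝ) < (i + 2 : ℝ) * (i + 1) := by positivity
    rw [show -u = (1 - u) + -1 by ring, Real.rpow_add hp, Real.rpow_neg_one]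
    gcongr ?_ * _
    exact Real.rpow_le_rpow_of_nonpos (by norm_num) (by nlinarith) (by linarith)
  calc _ ≤ ∑' i : ℕ, ENNReal.ofReal (2 ^ (1 - u)) * ENNReal.ofReal (((i + 2 : ℝ) * (i + 1))⁻¹) :=
        ENNReal.tsum_le_tsum h
    _ ≤ ENNReal.ofReal (2 ^ (1 - u)) * 1 := by
        rw [ENNReal.tsum_mul_left]
        gcongr
        exact tsum_inv_mul_succ
    _ < 1 := by
        rw [mul_one, ENNReal.ofReal_lt_one]
        exact Real.rpow_lt_one_of_one_lt_of_neg (by norm_num) (by linarith)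

theorem tsum_rpow_add_two_ne_top {u : ℝ} (hu : 1 < u) :
    ∑' i : ℕ, ENNReal.ofReal ((i + 2 : ℝ) ^ (-u)) ≠ ∞ := by
  have h := (summable_nat_add_iff 2).2 (Real.summable_nat_rpow.2 (show -u < -1 by linarith))
  have := h.tsum_ofReal_ne_top
  simpa using this

theorem denom_congr {d e : ℕ → ℕ} {n : ℕ} (hn : 1 ≤ n) (h : ∀ j, 1 ≤ j → j ≤ n → d j = e j) :
    denom d n = denom e n := by
  unfold denom
  rw [h n hn le_rfl]
  congr 1
  refine Finset.prod_congr rfl fun j hj => ?_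
  rw [Finset.mem_Ico] at hj
  rw [h j hj.1 hj.2.le]

theorem convergent_congr {d e : ℕ → ℕ} {n : ℕ} (h : ∀ j, 1 ≤ j → j ≤ n → d j = e j) :
    convergent d n = convergent e n := by
  refine Finset.sum_congr rfl fun k hk => ?_
  rw [Finset.mem_Icc] at hk
  rw [denom_congr hk.1 fun j h1 h2 => h j h1 (h2.trans hk.2)]

theorem two_pow_le_denom {d : ℕ → ℕ} (hd : ∀ j, 2 ≤ d j) {n : ℕ} (hn : 1 ≤ n) :
    2 ^ n ≤ denom d n := by
  obtain ⟨k, rfl⟩ : ∃ k, n = k + 1 := ⟨n - 1, by omega⟩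
  rw [denom, pow_succ']
  refine Nat.mul_le_mul (hd _) ?_
  calc 2 ^ k = ∏ j ∈ Finset.Ico 1 (k + 1), 2 := by simp
    _ ≤ _ := by
      refine Finset.prod_le_prod' fun j _ => ?_
      have := hd j
      calc 2 = 2 * 1 := rfl
        _ ≤ _ := Nat.mul_le_mul this (by omega)

theorem P_div_Q {x : ℝ} (hx : x ∈ Ioc (0 : ℝ) 1) {n : ℕ} (hn : 1 ≤ n) :
    P n x / (Q n x : ℝ) = convergent (digit x) n := by
  have h := two_pow_le_denom (two_le_digit hx) hn
  have : (Q n x : ℝ) ≠ 0 := by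
    have : 0 < 2 ^ n := by positivity
    unfold Q
    exact_mod_cast (by omega : denom (digit x) n ≠ 0)
  rw [P, mul_div_cancel_right₀ _ this]

/-- The points that are approximated by infinitely many of their Lüroth convergents to the order
`1 + s`. -/
def wellApprox (s : ℝ) : Set ℝ :=
  {x | x ∈ Ioc (0 : ℝ) 1 ∧
    ∃ᶠ n in atTop, |x - P n x / (Q n x : ℝ)| < (Q n x : ℝ) ^ (-(1 + s))}

theorem dimH_wellApprox_le {s t : ℝ} (hs : 0 ≤ s) (ht0 : 0 ≤ t) (ht : 1 < (1 + s) * t) :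
    dimH (wellApprox s) ≤ ENNReal.ofReal t := by
  let A : (k : ℕ) → ℕ × (Fin k → ℕ) → Set ℝ := fun k p =>
    {x | x ∈ Ioc (0 : ℝ) 1 ∧ digit x (k + 1) = p.1 + 2 ∧ (∀ i : Fin k, digit x (i + 1) = p.2 i + 2) ∧
      |x - P (k + 1) x / (Q (k + 1) x : ℝ)| < (Q (k + 1) x : ℝ) ^ (-(1 + s))}
  let q : (k : ℕ) → ℕ × (Fin k → ℕ) → ℝ := fun k p =>
    (p.1 + 2) * ∏ i, ((p.2 i + 2 : ℝ) * (p.2 i + 1))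
  have hq : ∀ k p, ∀ x ∈ A k p, (Q (k + 1) x : ℝ) = q k p := by
    rintro k p x ⟨-, h1, h2, -⟩
    simp only [Q, denom, q]
    rw [h1, Finset.prod_Ico_eq_prod_range, Nat.add_sub_cancel, ← Fin.prod_univ_eq_prod_range
      (fun j => digit x (1 + j) * (digit x (1 + j) - 1)) k]
    push_cast
    congr 1
    refine Finset.prod_congr rfl fun i _ => ?_
    rw [add_comm, h2 i]
    push_cast
    ring_nf
  have hq2 : ∀ k p, 2 ^ k ≤ q k p := fun k p => by
    have h1 : (2 : ℝ) ^ k ≤ ∏ i, ((p.2 i + 2 : ℝ) * (p.2 i + 1)) := by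
      calc (2 : ℝ) ^ k = ∏ i : Fin k, 2 := by simp
        _ ≤ _ := by
          refine Finset.prod_le_prod (fun _ _ => by norm_num) fun i _ => ?_
          have : (0 : ℝ) ≤ p.2 i := by positivity
          nlinarith
    have h2 : (1 : ℝ) ≤ p.1 + 2 := by
      have : (0 : ℝ) ≤ p.1 := by positivity
      linarith
    calc (2 : ℝ) ^ k = 1 * 2 ^ k := (one_mul _).symm
      _ ≤ _ := mul_le_mul h2 h1 (by positivity) (by positivity)
  have hq1 : ∀ k p, 1 ≤ q k p := fun k p => (one_le_pow₀ (by norm_num)).trans (hq2 k p)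
  have hdiam : ∀ k p, Metric.ediam (A k p) ≤ ENNReal.ofReal (2 * q k p ^ (-(1 + s))) := by
    intro k p
    refine Metric.ediam_le fun x hx y hy => ?_
    rw [edist_dist]
    apply ENNReal.ofReal_le_ofReal
    have hcx := hq k p x hx
    have hcy := hq k p y hy
    have hc : convergent (digit x) (k + 1) = convergent (digit y) (k + 1) := by
      refine convergent_congr fun j h1 h2 => ?_
      obtain ⟨i, rfl⟩ : ∃ i, j = i + 1 := ⟨j - 1, by omega⟩
      rcases (by omega : i = k ∨ i < k) with rfl | h
      · rw [hx.2.1, hy.2.1]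
      · rw [hx.2.2.1 ⟨i, h⟩, hy.2.2.1 ⟨i, h⟩]
    have hxa := hx.2.2.2
    have hya := hy.2.2.2
    rw [P_div_Q hx.1 (by omega), hcx] at hxa
    rw [P_div_Q hy.1 (by omega), hcy, ← hc] at hya
    rw [Real.dist_eq]
    rw [abs_lt] at hxa hya
    rw [abs_le]
    constructor <;> linarith
  set u := (1 + s) * t with hu
  let a : ℕ → ℝ≥0∞ := fun i => ENNReal.ofReal ((i + 2 : ℝ) ^ (-u))
  let b : ℕ → ℝ≥0∞ := fun i => ENNReal.ofReal (((i + 2 : ℝ) * (i + 1)) ^ (-u))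
  have hpow : ∀ k p, Metric.ediam (A k p) ^ t ≤
      ENNReal.ofReal (2 ^ t) * (a p.1 * ∏ i, b (p.2 i)) := by
    intro k p
    refine (ENNReal.rpow_le_rpow (hdiam k p) ht0).trans ?_
    have h0 : 0 ≤ q k p := by linarith [hq1 k p]
    rw [ENNReal.ofReal_rpow_of_nonneg (by positivity) ht0, Real.mul_rpow (by norm_num) (by positivity),
      ENNReal.ofReal_mul (by positivity), ← Real.rpow_mul h0,
      show -(1 + s) * t = -u by rw [hu]; ring]
    simp only [q, a, b]
    rw [Real.mul_rpow (by positivity) (by positivity), ENNReal.ofReal_mul (by positivity),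
      ← Real.finsetProd_rpow _ _ (fun i _ => by positivity),
      ENNReal.ofReal_prod_of_nonneg fun i _ => by positivity]
  -- The full series bounds all its tails, so K does not depend on the least word length in the
  -- cover.
  set K : ℝ≥0∞ := ENNReal.ofReal (2 ^ t) * ((∑' i, a i) * (1 - ∑' i, b i)⁻¹) with hK
  have hsum : ∀ n : ℕ, ∑' i : (Σ k : ℕ, ℕ × (Fin (k + n) → ℕ)), Metric.ediam (A (i.1 + n) i.2) ^ t ≤ K := by
    intro n
    rw [ENNReal.tsum_sigma']
    calc _ ≤ ∑' k : ℕ, ENNReal.ofReal (2 ^ t) * ((∑' i, a i) * (∑' i, b i) ^ k) := by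
          refine ENNReal.tsum_le_tsum fun k => ?_
          refine (ENNReal.tsum_le_tsum fun p => hpow _ p).trans ?_
          rw [ENNReal.tsum_mul_left, ENNReal.tsum_prod']
          simp only [ENNReal.tsum_mul_left, ENNReal.tsum_mul_right]
          rw [ENNReal.tsum_pi_prod]
          gcongr ?_ * (?_ * ?_)
          · exact le_rfl
          · exact le_rfl
          · exact pow_le_pow_right_of_le_one' (tsum_rpow_mul_succ_lt_one ht).le (Nat.le_add_right k n)
      _ = K := by rw [ENNReal.tsum_mul_left, ENNReal.tsum_mul_left, ENNReal.tsum_geometric]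
  have hKtop : K ≠ ∞ := by
    refine ENNReal.mul_ne_top ENNReal.ofReal_ne_top
      (ENNReal.mul_ne_top (tsum_rpow_add_two_ne_top ht) ?_)
    rw [ENNReal.inv_ne_top]
    exact (tsub_pos_of_lt (tsum_rpow_mul_succ_lt_one ht)).ne'
  have hcover : ∀ n : ℕ, wellApprox s ⊆ ⋃ i : (Σ k : ℕ, ℕ × (Fin (k + n) → ℕ)), A (i.1 + n) i.2 := by
    rintro n x ⟨hx, hfr⟩
    obtain ⟨N, hN, hxN⟩ := (frequently_atTop.1 hfr) (n + 1)
    obtain ⟨k, rfl⟩ : ∃ k, N = k + n + 1 := ⟨N - n - 1, by omega⟩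
    refine mem_iUnion.2 ⟨⟨k, digit x (k + n + 1) - 2, fun i => digit x (i + 1) - 2⟩, hx, ?_, ?_, hxN⟩
    · have := two_le_digit hx (k + n + 1)
      simp only; omega
    · intro i
      have := two_le_digit hx (i + 1)
      simp only; omega
  have hr : Tendsto (fun n : ℕ => ENNReal.ofReal (2 * (1 / 2) ^ n)) atTop (𝓝 0) := by
    rw [← ENNReal.ofReal_zero]
    apply ENNReal.tendsto_ofReal
    have := (tendsto_pow_atTop_nhds_zero_of_lt_one (r := (1 / 2 : ℝ)) (by norm_num)
      (by norm_num)).const_mul 2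
    simpa using this
  have hμ : μH[((⟨t, ht0⟩ : NNReal) : ℝ)] (wellApprox s) ≠ ∞ := by
    refine ne_top_of_le_ne_top hKtop ?_
    refine (Measure.hausdorffMeasure_le_liminf_tsum (ι := fun n => Σ k : ℕ, ℕ × (Fin (k + n) → ℕ))
      t (wellApprox s) _ hr (fun n i => A (i.1 + n) i.2) (Eventually.of_forall fun n i => ?_)
      (Eventually.of_forall hcover)).trans ?_
    · refine (hdiam _ _).trans (ENNReal.ofReal_le_ofReal ?_)
      have h1 := hq2 (i.1 + n) i.2
      have h2 := hq1 (i.1 + n) i.2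
      gcongr
      calc q (i.1 + n) i.2 ^ (-(1 + s)) ≤ q (i.1 + n) i.2 ^ (-1 : ℝ) :=
            Real.rpow_le_rpow_of_exponent_le h2 (by linarith)
        _ = (q (i.1 + n) i.2)⁻¹ := Real.rpow_neg_one _
        _ ≤ (2 ^ n)⁻¹ := by
            apply inv_anti₀ (by positivity)
            exact (pow_le_pow_right₀ (by norm_num) (by omega)).trans h1
        _ = (1 / 2) ^ n := by rw [one_div, inv_pow]
    · refine (liminf_le_liminf (Eventually.of_forall hsum)).trans ?_
      rw [liminf_const]
  refine (dimH_le_of_hausdorffMeasure_ne_top hμ).trans ?_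
  rw [ENNReal.ofReal, Real.toNNReal_of_nonneg ht0]
  exact le_rfl

end Luroth

/-! ### Dimension from a Hölder inverse coding -/

/-- The hypothesis makes `f` injective on `s` with a `t`-Hölder inverse. -/
theorem le_dimH_image_of_dist_le {f : ℝ → ℝ} {s : Set ℝ} {C t : ℝ} (hC : 0 ≤ C) (ht : 0 < t)
    (h : ∀ x ∈ s, ∀ y ∈ s, |x - y| ≤ C * |f x - f y| ^ t) :
    dimH s ≤ dimH (f '' s) / ENNReal.ofReal t := by
  have hinj : InjOn f s := fun x hx y hy hxy => by
    have := h x hx y hy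
    rw [hxy, sub_self, abs_zero, Real.zero_rpow ht.ne', mul_zero] at this
    exact sub_eq_zero.1 (abs_nonpos_iff.1 this)
  have hleft := hinj.leftInvOn_invFunOn
  have hH : HolderOnWith C.toNNReal t.toNNReal (Function.invFunOn f s) (f '' s) := by
    rintro _ ⟨x, hx, rfl⟩ _ ⟨y, hy, rfl⟩
    rw [hleft hx, hleft hy, edist_dist, edist_dist, Real.coe_toNNReal t ht.le,
      ENNReal.ofReal_rpow_of_nonneg dist_nonneg ht.le]
    change _ ≤ ENNReal.ofReal C * _
    rw [← ENNReal.ofReal_mul hC]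
    exact ENNReal.ofReal_le_ofReal (h x hx y hy)
  have := hH.dimH_image_le (Real.toNNReal_pos.2 ht)
  rwa [hleft.image_image] at this

/-- Lower bound for the dimension of a set coded by the digits of a mixed radix expansion. -/
theorem le_dimH_of_mixed_radix {m M : ℕ → ℕ} (hm : ∀ k, 2 ≤ m k) (hM0 : M 0 = 1)
    (hM : ∀ k, M (k + 1) = M k * m k) {E : Set ℝ} {g : (ℕ → ℕ) → ℝ}
    (hg : ∀ a : ℕ → ℕ, (∀ k, a k < m k) → g a ∈ E) {η : ℕ → ℝ} (hη : ∀ k, 0 < η k)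
    (hsep : ∀ a b : ℕ → ℕ, (∀ k, a k < m k) → (∀ k, b k < m k) → ∀ k, (∀ i < k, a i = b i) →
      a k ≠ b k → η k * |(a k : ℝ) - b k| ≤ |g a - g b|)
    {t C : ℝ} (ht : 0 < t) (ht1 : t ≤ 1) (hC : 0 ≤ C)
    (hηM : ∀ k, (M k : ℝ)⁻¹ ≤ C * (η k * m k) ^ t) : ENNReal.ofReal t ≤ dimH E := by
  have hM2 : ∀ k, 2 ^ k ≤ M k := fun k => by
    induction k with
    | zero => simp [hM0]
    | succ k ih => rw [hM, pow_succ]; exact Nat.mul_le_mul ih (hm k)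
  -- The mixed radix digits of y, in which M k is the number of words formed by the first k digits.
  let a : ℝ → ℕ → ℕ := fun y k => ⌊y * M (k + 1)⌋₊ % m k
  have ha : ∀ y k, a y k < m k := fun y k => Nat.mod_lt _ (by have := hm k; omega)
  have hfl : ∀ (y : ℝ) (k : ℕ), ⌊y * M (k + 1)⌋₊ = m k * ⌊y * M k⌋₊ + a y k := fun y k => by
    have h1 : ⌊y * M k⌋₊ = ⌊y * M (k + 1)⌋₊ / m k := by
      rw [← Nat.floor_div_natCast, hM]
      have : (m k : ℝ) ≠ 0 := by have := hm k; positivity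
      congr 1
      push_cast
      field_simp
    rw [h1]
    exact (Nat.div_add_mod _ _).symm
  have hfloor : ∀ y ∈ Ico (0 : ℝ) 1, ∀ z ∈ Ico (0 : ℝ) 1, ∀ k, (∀ i < k, a y i = a z i) →
      ⌊y * M k⌋₊ = ⌊z * M k⌋₊ := by
    intro y hy z hz k
    induction k with
    | zero =>
      intro _
      simp only [hM0, Nat.cast_one, mul_one]
      rw [Nat.floor_eq_zero.2 hy.2, Nat.floor_eq_zero.2 hz.2]
    | succ k ih =>
      intro h
      rw [hfl, hfl, ih fun i hi => h i (by omega), h k (by omega)]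
  have key : ∀ y ∈ Ico (0 : ℝ) 1, ∀ z ∈ Ico (0 : ℝ) 1,
      |y - z| ≤ 2 * C * |g (a y) - g (a z)| ^ t := by
    intro y hy z hz
    by_cases hyz : y = z
    · rw [hyz, sub_self, abs_zero]; positivity
    have hdist : ∀ k : ℕ, |y - z| * M k ≤ |(⌊y * M k⌋₊ : ℝ) - ⌊z * M k⌋₊| + 1 := fun k => by
      have hk : (0 : ℝ) ≤ M k := by positivity
      have h1 := Nat.floor_le (mul_nonneg hy.1 hk)
      have h2 := Nat.lt_floor_add_one (y * M k)
      have h3 := Nat.floor_le (mul_nonneg hz.1 hk)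
      have h4 := Nat.lt_floor_add_one (z * M k)
      rw [← abs_of_nonneg hk, ← abs_mul, sub_mul, abs_of_nonneg hk, abs_le]
      have h5 := le_abs_self ((⌊y * M k⌋₊ : ℝ) - ⌊z * M k⌋₊)
      have h6 := neg_abs_le ((⌊y * M k⌋₊ : ℝ) - ⌊z * M k⌋₊)
      constructor <;> linarith
    have hex : ∃ k, a y k ≠ a z k := by
      by_contra! hall
      obtain ⟨k, hk⟩ := pow_unbounded_of_one_lt (1 / |y - z|) (show (1 : ℝ) < 2 by norm_num)
      have hpos : 0 < |y - z| := abs_pos.2 (sub_ne_zero.2 hyz)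
      have h1 := hdist k
      rw [hfloor y hy z hz k fun i _ => hall i, sub_self, abs_zero, zero_add] at h1
      rw [div_lt_iff₀ hpos] at hk
      have h2 : (2 : ℝ) ^ k ≤ M k := by exact_mod_cast hM2 k
      nlinarith
    classical
    let k := Nat.find hex
    have hk : a y k ≠ a z k := Nat.find_spec hex
    have hlt : ∀ i < k, a y i = a z i := fun i hi => not_not.1 (Nat.find_min hex hi)
    have hs := hsep (a y) (a z) (ha y) (ha z) k hlt hk
    set j : ℝ := |(a y k : ℝ) - a z k| with hj
    have hj1 : 1 ≤ j := by
      have : (1 : ℤ) ≤ |(a y k : ℤ) - a z k| := Int.one_le_abs (by omega)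
      rw [hj]
      exact_mod_cast this
    have hjm : j ≤ m k := by
      have h1 : (a y k : ℝ) ≤ m k := by exact_mod_cast (ha y k).le
      have h2 : (a z k : ℝ) ≤ m k := by exact_mod_cast (ha z k).le
      have h3 : (0 : ℝ) ≤ a y k := by positivity
      have h4 : (0 : ℝ) ≤ a z k := by positivity
      rw [hj, abs_le]
      constructor <;> linarith
    have hd := hdist (k + 1)
    rw [hfl, hfl, hfloor y hy z hz k hlt] at hd
    push_cast at hd
    rw [add_sub_add_left_eq_sub, ← hj, hM] at hd
    push_cast at hd
    have hmk : (0 : ℝ) < m k := by linarith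
    have hMk : (0 : ℝ) < M k := by
      have := hM2 k
      have : 0 < 2 ^ k := by positivity
      exact_mod_cast (by omega : 0 < M k)
    have hq0 : 0 ≤ j / m k := by positivity
    have hq1 : j / m k ≤ 1 := (div_le_one hmk).2 hjm
    -- If the first differing digits differ by j ≥ 1, then |y - z| ≤ (j + 1)/(M m) ≤ 2j/(M m). As
    -- j/m ≤ 1 and t ≤ 1, j/m may be replaced by (j/m)^t and absorbed into the separation.
    calc |y - z| = |y - z| * (M k * m k) / (M k * m k) := by field_simp
      _ ≤ (2 * j) / (M k * m k) := by
          refine div_le_div_of_nonneg_right ?_ (by positivity)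
          linarith
      _ = 2 * ((j / m k) ^ (1 : ℝ) * (M k : ℝ)⁻¹) := by rw [Real.rpow_one]; field_simp
      _ ≤ 2 * ((j / m k) ^ t * (C * (η k * m k) ^ t)) := by
          refine mul_le_mul_of_nonneg_left ?_ (by norm_num)
          exact mul_le_mul (Real.rpow_le_rpow_of_exponent_ge (by positivity) hq1 ht1) (hηM k)
            (by positivity) (by positivity)
      _ = 2 * C * ((j / m k) * (η k * m k)) ^ t := by
          rw [Real.mul_rpow hq0 (by have := hη k; positivity)]; ring
      _ = 2 * C * (η k * j) ^ t := by
          congr 2; field_simp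
      _ ≤ _ := by
          gcongr
          have := hη k
          positivity
  have h1 := le_dimH_image_of_dist_le (by positivity) ht key
  have h2 : dimH (Ico (0 : ℝ) 1) = 1 := by
    rw [Real.dimH_of_nonempty_interior]
    · simp
    · simp
  rw [h2, ENNReal.le_div_iff_mul_le (by simp [ht]) (by simp), one_mul] at h1
  refine h1.trans (dimH_mono ?_)
  rintro _ ⟨y, -, rfl⟩
  exact hg _ (ha y)

/-! ### A Cantor set of well approximable points -/

namespace Luroth

/-- Nested compact cylinders have a common point. The digit 2 closing each block places the
remaining point in the upper half [1/2, 1], as the separation lemmas require. -/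
theorem exists_point {v w : ℕ → List ℕ} (hv : ∀ k, ∀ d ∈ v k, 2 ≤ d)
    (hw : ∀ k, w (k + 1) = w k ++ (v k ++ [2])) :
    ∃ x, ∀ k, ∃ y ∈ Icc (1 / 2 : ℝ) 1, x = cylMap (w k) (cylMap (v k) y) := by
  have hstep : ∀ k u, cylMap (w (k + 1)) u = cylMap (w k) (cylMap (v k) (branch 2 u)) := by
    intro k u
    rw [hw, cylMap_append, cylMap_append]
    rfl
  have hb : ∀ u ∈ Icc (0 : ℝ) 1, branch 2 u ∈ Icc (1 / 2 : ℝ) 1 := fun u hu => by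
    have := branch_mem_Icc (le_refl 2) hu
    norm_num at this
    simpa using this
  have hcont : ∀ k, Continuous (cylMap (w k)) := fun k => by
    have : cylMap (w k) = fun u => cylLen (w k) * (u - 0) + cylMap (w k) 0 := by
      ext u
      rw [← cylMap_sub]
      ring
    rw [this]
    fun_prop
  have hcomp : ∀ k, IsCompact (cylMap (w k) '' Icc (0 : ℝ) 1) := fun k =>
    isCompact_Icc.image (hcont k)
  obtain ⟨x, hx⟩ := IsCompact.nonempty_iInter_of_sequence_nonempty_isCompact_isClosed
    (fun k => cylMap (w k) '' Icc (0 : ℝ) 1)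
    (fun k => by
      rintro _ ⟨u, hu, rfl⟩
      rw [hstep]
      refine ⟨_, cylMap_mem_Icc (hv k) ?_, rfl⟩
      have := hb u hu
      exact ⟨by linarith [this.1], this.2⟩)
    (fun k => ⟨_, mem_image_of_mem _ (left_mem_Icc.2 zero_le_one)⟩) (hcomp 0)
    (fun k => (hcomp k).isClosed)
  refine ⟨x, fun k => ?_⟩
  obtain ⟨u, hu, rfl⟩ := mem_iInter.1 hx (k + 1)
  exact ⟨branch 2 u, hb u hu, hstep k u⟩

/-- A last digit d = 2 satisfies d = d(d-1), so the denominator is exactly the inverse of the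
cylinder length. -/
theorem sub_P_div_Q_cylMap {w : List ℕ} (hw : ∀ d ∈ w, 2 ≤ d) {u : ℝ} (hu : u ∈ Ioc (0 : ℝ) 1) :
    cylMap (w ++ [2]) u - P (w ++ [2]).length (cylMap (w ++ [2]) u) /
        (Q (w ++ [2]).length (cylMap (w ++ [2]) u) : ℝ) = cylLen (w ++ [2]) * u ∧
      (Q (w ++ [2]).length (cylMap (w ++ [2]) u) : ℝ) = (cylLen (w ++ [2]))⁻¹ := by
  have hw2 : ∀ d ∈ w ++ [2], 2 ≤ d := by
    intro d hd
    rcases List.mem_append.1 hd with h | h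
    · exact hw d h
    · simp_all
  have hx := cylMap_mem_Ioc hw2 hu
  have hprod := prod_digit_cylMap hw2 hu
  have hpos := cylLen_pos hw2
  constructor
  · have h := sub_convergent hx (w ++ [2]).length
    rw [hprod, iterate_cylMap hw2 hu] at h
    rw [P_div_Q hx (by simp), mul_comm]
    rwa [← div_eq_mul_inv, div_eq_iff hpos.ne'] at h
  · rw [← hprod, List.length_append, List.length_singleton, Finset.prod_Ico_succ_top (by omega),
      digit_cylMap_append hw le_rfl hu, Q, denom, digit_cylMap_append hw le_rfl hu]
    push_cast
    ring

/-- A recursion on the pair (M, ρ): `D` collects the stages at which there are enough words to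
afford a large digit; all other stages use a free block. -/
theorem exists_scheme (m₀ : ℕ) (r₀ s τ : ℝ) :
    ∃ (M m : ℕ → ℕ) (ρ : ℕ → ℝ) (D : Set ℕ), M 0 = 1 ∧ ρ 0 = 1 ∧ (∀ k, M (k + 1) = M k * m k) ∧
      (∀ k ∈ D, (M k : ℝ)⁻¹ ≤ ρ k ^ τ ∧ m k = ⌊ρ k ^ (-s)⌋₊ + 2 ∧
        ρ (k + 1) = ρ k * (1 / (8 * (m k : ℝ) ^ 2))) ∧
      (∀ k ∉ D, ρ k ^ τ < (M k : ℝ)⁻¹ ∧ m k = m₀ ∧ ρ (k + 1) = ρ k * r₀) := by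
  classical
  let num : ℕ × ℝ → ℕ := fun p => if (p.1 : ℝ)⁻¹ ≤ p.2 ^ τ then ⌊p.2 ^ (-s)⌋₊ + 2 else m₀
  let rat : ℕ × ℝ → ℝ := fun p => if (p.1 : ℝ)⁻¹ ≤ p.2 ^ τ then 1 / (8 * (num p : ℝ) ^ 2) else r₀
  let st : ℕ → ℕ × ℝ := fun k => Nat.rec (1, 1) (fun _ p => (p.1 * num p, p.2 * rat p)) k
  refine ⟨fun k => (st k).1, fun k => num (st k), fun k => (st k).2,
    {k | ((st k).1 : ℝ)⁻¹ ≤ (st k).2 ^ τ}, rfl, rfl, fun k => rfl, fun k hk => ?_, fun k hk => ?_⟩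
  · refine ⟨hk, if_pos hk, ?_⟩
    change (st k).2 * rat (st k) = _
    simp only [rat]
    rw [if_pos (show ((st k).1 : ℝ)⁻¹ ≤ (st k).2 ^ τ from hk)]
  · refine ⟨not_le.1 hk, if_neg hk, ?_⟩
    change (st k).2 * rat (st k) = _
    simp only [rat]
    rw [if_neg (show ¬ ((st k).1 : ℝ)⁻¹ ≤ (st k).2 ^ τ from hk)]

theorem le_dimH_wellApprox {s t : ℝ} (hs : 0 < s) (ht : 0 < t) (hst : (1 + s) * t < 1) :
    ENNReal.ofReal t ≤ dimH (wellApprox s) := by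
  have ht1 : t ≤ 1 := by nlinarith
  set τ := (1 + s) * t with hτ
  have htτ : t ≤ τ := by nlinarith
  obtain ⟨σ, hτσ, hσ1⟩ := exists_between hst
  have hσ0 : 0 < σ := by nlinarith
  obtain ⟨m₀, r, n, W, hr0, hr1, hmr, hW, hWinj⟩ := exists_words hσ0 hσ1
  have hm0 : 2 ≤ m₀ := by
    have h1 : r ^ σ < 1 := Real.rpow_lt_one hr0.le hr1 hσ0
    have h2 : 0 < r ^ σ := Real.rpow_pos_of_pos hr0 σ
    by_contra h
    have h3 : (m₀ : ℝ) ≤ 1 := by exact_mod_cast (by omega : m₀ ≤ 1)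
    nlinarith
  have hm0' : (2 : ℝ) ≤ m₀ := by exact_mod_cast hm0
  have hminv : (m₀ : ℝ)⁻¹ ≤ r ^ σ := by
    rw [inv_le_iff_one_le_mul₀ (by linarith)]; linarith
  obtain ⟨M, m, ρ, D, hM0, hρ0, hM, hD, hnD⟩ := exists_scheme m₀ r s τ
  have hm : ∀ k, 2 ≤ m k := fun k => by
    by_cases h : k ∈ D
    · rw [(hD k h).2.1]; omega
    · rw [(hnD k h).2.1]; exact hm0
  have hm' : ∀ k, (2 : ℝ) ≤ m k := fun k => by exact_mod_cast hm k
  have hρ : ∀ k, 0 < ρ k ∧ ρ k ≤ 1 := fun k => by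
    induction k with
    | zero => simp [hρ0]
    | succ k ih =>
      have := hm' k
      by_cases h : k ∈ D
      · rw [(hD k h).2.2]
        have h8 : 1 / (8 * (m k : ℝ) ^ 2) ≤ 1 := by
          rw [div_le_one (by positivity)]; nlinarith
        exact ⟨mul_pos ih.1 (by positivity), mul_le_one₀ ih.2 (by positivity) h8⟩
      · rw [(hnD k h).2.2]
        exact ⟨mul_pos ih.1 hr0, mul_le_one₀ ih.2 hr0.le hr1.le⟩
  have hMpos : ∀ k, (0 : ℝ) < M k := fun k => by
    induction k with
    | zero => simp [hM0]
    | succ k ih =>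
      have := hm' k
      rw [hM]; push_cast; positivity
  have hmle : ∀ k ∈ D, ρ k ^ s / 3 ≤ (m k : ℝ)⁻¹ := fun k hk => by
    obtain ⟨h0, h1⟩ := hρ k
    have h2 : 1 ≤ ρ k ^ (-s) := Real.one_le_rpow_of_pos_of_le_one_of_nonpos h0 h1 (by linarith)
    have h3 : (m k : ℝ) ≤ 3 * ρ k ^ (-s) := by
      rw [(hD k hk).2.1]
      push_cast
      have := Nat.floor_le (show 0 ≤ ρ k ^ (-s) by linarith)
      linarith
    rw [Real.rpow_neg h0.le] at h3
    have h4 : 0 < ρ k ^ s := Real.rpow_pos_of_pos h0 s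
    have := hm' k
    rw [le_inv_comm₀ (by positivity) (by linarith), inv_div]
    exact h3
  have hρτ : ∀ k, ρ k ^ τ = (ρ k * ρ k ^ s) ^ t := fun k => by
    rw [← Real.rpow_one_add' (hρ k).1.le (by linarith), ← Real.rpow_mul (hρ k).1.le]
  -- The invariant surviving both kinds of stage. Here 24 = 3 · 8, from ρ^s ≤ 3/m and from the
  -- shrinking factor 1/(8m²).
  have hinv : ∀ k, (M k : ℝ)⁻¹ ≤ (24 * ρ k) ^ t := fun k => by
    induction k with
    | zero =>
      rw [hM0, hρ0]
      simpa using Real.one_le_rpow (show (1 : ℝ) ≤ 24 by norm_num) ht.le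
    | succ k ih =>
      have hmk := hm' k
      obtain ⟨h0, h1⟩ := hρ k
      rw [hM, Nat.cast_mul, mul_inv]
      by_cases h : k ∈ D
      · have h2 : (m k : ℝ)⁻¹ ≤ ((m k : ℝ)⁻¹) ^ t := by
          conv_lhs => rw [← Real.rpow_one (m k : ℝ)⁻¹]
          exact Real.rpow_le_rpow_of_exponent_ge (by positivity)
            (inv_le_one_of_one_le₀ (by linarith)) ht1
        have hpos : 0 < ρ k ^ s := Real.rpow_pos_of_pos h0 s
        calc (M k : ℝ)⁻¹ * (m k : ℝ)⁻¹ ≤ (ρ k * ρ k ^ s) ^ t * ((m k : ℝ)⁻¹) ^ t := by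
              rw [← hρτ]
              gcongr
              exact (hD k h).1
          _ = (ρ k * ρ k ^ s * (m k : ℝ)⁻¹) ^ t := by
              rw [← Real.mul_rpow (by positivity) (by positivity)]
          _ ≤ (24 * ρ (k + 1)) ^ t := by
              apply Real.rpow_le_rpow (by positivity) _ ht.le
              rw [(hD k h).2.2]
              have := hmle k h
              calc ρ k * ρ k ^ s * (m k : ℝ)⁻¹ ≤ ρ k * (3 * (m k : ℝ)⁻¹) * (m k : ℝ)⁻¹ := by
                    gcongr; linarith
                _ = _ := by field_simp; norm_num
      · rw [(hnD k h).2.2, (hnD k h).2.1, ← mul_assoc, Real.mul_rpow (by positivity) hr0.le]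
        gcongr
        exact hminv.trans (Real.rpow_le_rpow_of_exponent_ge hr0 hr1.le (by linarith))
  -- With free blocks only, M⁻¹ would decay at least like ρ^σ with σ > τ, and so would drop below
  -- ρ^τ.
  have hinf : ∀ K, ∃ k ≥ K, k ∈ D := by
    intro K
    by_contra! hK
    have h1 : ∀ l, (M (K + l) : ℝ) = M K * (m₀ : ℝ) ^ l ∧ ρ (K + l) = ρ K * r ^ l := fun l => by
      induction l with
      | zero => simp
      | succ l ih =>
        obtain ⟨-, h2, h3⟩ := hnD (K + l) (hK _ (by omega))
        rw [← add_assoc, hM, h2, h3, ih.2]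
        push_cast
        rw [ih.1]
        constructor <;> ring
    have h0 := (hρ K).1
    have hρK : 0 < ρ K ^ τ := Real.rpow_pos_of_pos h0 τ
    have hMK := hMpos K
    obtain ⟨l, hl⟩ := exists_pow_lt_of_lt_one (show 0 < M K * ρ K ^ τ by positivity)
      (Real.rpow_lt_one hr0.le hr1 (show 0 < σ - τ by linarith))
    obtain ⟨h2, -, -⟩ := hnD (K + l) (hK _ (by omega))
    rw [(h1 l).1, (h1 l).2, mul_inv, Real.mul_rpow h0.le (by positivity), ← inv_pow] at h2
    have h3 : (r ^ l) ^ τ = (r ^ τ) ^ l := by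
      rw [← Real.rpow_natCast, ← Real.rpow_mul hr0.le, mul_comm, Real.rpow_mul hr0.le,
        Real.rpow_natCast]
    have hrl : 0 < (r ^ τ) ^ l := by positivity
    have h4 : ((m₀ : ℝ)⁻¹) ^ l ≤ (r ^ (σ - τ)) ^ l * (r ^ τ) ^ l := by
      rw [← mul_pow, ← Real.rpow_add hr0, sub_add_cancel]
      gcongr
    rw [h3] at h2
    have h5 : (M K : ℝ)⁻¹ * ((m₀ : ℝ)⁻¹) ^ l ≤ ρ K ^ τ * (r ^ τ) ^ l := by
      calc (M K : ℝ)⁻¹ * ((m₀ : ℝ)⁻¹) ^ l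
          ≤ (M K : ℝ)⁻¹ * ((M K * ρ K ^ τ) * (r ^ τ) ^ l) := by
            gcongr
            refine h4.trans ?_
            gcongr
        _ = _ := by field_simp
    linarith
  classical
  let v : ℕ → ℕ → List ℕ := fun k j => if k ∈ D then [m k + j] else W j
  have hv2 : ∀ k, ∀ j < m k, ∀ d ∈ v k j, 2 ≤ d := by
    intro k j hj d hd
    simp only [v] at hd
    split_ifs at hd with h
    · have := hm k
      simp only [List.mem_singleton] at hd
      omega
    · rw [(hnD k h).2.1] at hj
      exact (hW j hj).2.1 d hd
  -- Large digits are at most 2m and the closing 2 halves the length, hence 8m²; for a free block,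
  -- the halving uses up the factor 2 in `2 * r`.
  have hvlen : ∀ k, ∀ j < m k, ρ (k + 1) ≤ ρ k * cylLen (v k j ++ [2]) := by
    intro k j hj
    have h0 := (hρ k).1
    simp only [v]
    split_ifs with h
    · rw [(hD k h).2.2]
      gcongr
      have h1 := hm' k
      have h2 : (j : ℝ) ≤ m k := by exact_mod_cast hj.le
      have h3 : (0 : ℝ) ≤ j := by positivity
      simp only [cylLen_append, cylLen_cons, cylLen_nil]
      push_cast
      have h4 : (m k + j : ℝ) * (m k + j - 1) ≤ (2 * m k) * (2 * m k) := by
        apply mul_le_mul <;> linarith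
      have h5 : 0 < (m k + j : ℝ) * (m k + j - 1) := by
        apply mul_pos <;> linarith
      calc 1 / (8 * (m k : ℝ) ^ 2) = ((2 * m k : ℝ) * (2 * m k))⁻¹ * 2⁻¹ := by field_simp; norm_num
        _ ≤ ((m k + j : ℝ) * (m k + j - 1))⁻¹ * 2⁻¹ := by gcongr
        _ = _ := by norm_num
    · obtain ⟨-, h1, h2⟩ := hnD k h
      rw [h1] at hj
      rw [h2]
      gcongr
      have := (hW j hj).2.2
      simp only [cylLen_append, cylLen_cons, cylLen_nil]
      norm_num
      linarith
  let w : (ℕ → ℕ) → ℕ → List ℕ := fun a k => Nat.rec [] (fun k l => l ++ (v k (a k) ++ [2])) k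
  have hw0 : ∀ a, w a 0 = [] := fun a => rfl
  have hw : ∀ a k, w a (k + 1) = w a k ++ (v k (a k) ++ [2]) := fun a k => rfl
  have hw2 : ∀ a : ℕ → ℕ, (∀ k, a k < m k) → ∀ k, ∀ d ∈ w a k, 2 ≤ d := by
    intro a ha k
    induction k with
    | zero => simp [hw0]
    | succ k ih =>
      intro d hd
      rw [hw, List.mem_append, List.mem_append] at hd
      rcases hd with h | h | h
      · exact ih d h
      · exact hv2 k _ (ha k) d h
      · simp_all
  have hwlen : ∀ a : ℕ → ℕ, (∀ k, a k < m k) → ∀ k, ρ k ≤ cylLen (w a k) := by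
    intro a ha k
    induction k with
    | zero => simp [hw0, hρ0]
    | succ k ih =>
      rw [hw, cylLen_append]
      refine (hvlen k _ (ha k)).trans ?_
      gcongr
      refine (cylLen_pos fun d hd => ?_).le
      rcases List.mem_append.1 hd with h | h
      · exact hv2 k _ (ha k) d h
      · simp_all
  have hwk : ∀ a k, k ≤ (w a k).length := by
    intro a k
    induction k with
    | zero => simp
    | succ k ih => rw [hw]; simp; omega
  have hwcongr : ∀ a b k, (∀ i < k, a i = b i) → w a k = w b k := by
    intro a b k
    induction k with
    | zero => simp [hw0]
    | succ k ih =>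
      intro h
      rw [hw, hw, ih fun i hi => h i (by omega), h k (by omega)]
  -- Inadmissible codes get the dummy value 0, so that the coding map is total.
  have hpt : ∀ a : ℕ → ℕ, ∃ x, (∀ k, a k < m k) →
      ∀ k, ∃ y ∈ Icc (1 / 2 : ℝ) 1, x = cylMap (w a k) (cylMap (v k (a k)) y) := by
    intro a
    by_cases ha : ∀ k, a k < m k
    · obtain ⟨x, hx⟩ := exists_point (v := fun k => v k (a k)) (fun k => hv2 k _ (ha k)) (hw a)
      exact ⟨x, fun _ => hx⟩
    · exact ⟨0, fun h => absurd h ha⟩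
  choose g hg using hpt
  -- Free words are only known to be at distance ρ r after rescaling, whatever their indices;
  -- dividing by m₀ ≥ |a k - b k| makes the bound linear in the index difference.
  refine le_dimH_of_mixed_radix hm hM0 hM (g := g) (η := fun k => ρ (k + 1) / m₀)
    (C := (24 * m₀ / r) ^ t) ?_ (fun k => div_pos (hρ _).1 (by linarith)) ?_ ht ht1 (by positivity) ?_
  · intro a ha
    have hIoc : ∀ y ∈ Icc (1 / 2 : ℝ) 1, y ∈ Ioc (0 : ℝ) 1 := fun y hy =>
      ⟨by linarith [hy.1], hy.2⟩
    refine ⟨?_, ?_⟩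
    · obtain ⟨y, hy, hxy⟩ := hg a ha 0
      rw [hxy]
      exact cylMap_mem_Ioc (hw2 a ha 0) (cylMap_mem_Ioc (hv2 0 _ (ha 0)) (hIoc y hy))
    · rw [frequently_atTop]
      intro K
      -- The shift forces k ≥ 1, so that the word before the large digit is nonempty and ends in 2.
      obtain ⟨k, hkK, hk⟩ := hinf (K + 1)
      refine ⟨(w a k).length, by have := hwk a k; omega, ?_⟩
      obtain ⟨y, hy, hxy⟩ := hg a ha k
      set u := cylMap (v k (a k)) y with hu
      have hu01 : u ∈ Ioc (0 : ℝ) 1 := cylMap_mem_Ioc (hv2 k _ (ha k)) (hIoc y hy)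
      have hρk := (hρ k).1
      have hult : u < ρ k ^ s := by
        have h1 : u = branch (m k + a k) y := by
          rw [hu]; simp only [v]; rw [if_pos hk]; rfl
        have h2 := (branch_mem_Icc (d := m k + a k) (by have := hm k; omega)
          (Ioc_subset_Icc_self (hIoc y hy))).2
        rw [h1]
        refine h2.trans_lt ?_
        have h3 : ρ k ^ (-s) < ((m k + a k : ℕ) : ℝ) - 1 := by
          have := Nat.lt_floor_add_one (ρ k ^ (-s))
          have h4 : (0 : ℝ) ≤ a k := by positivity
          rw [(hD k hk).2.1]
          push_cast
          linarith
        rw [Real.rpow_neg hρk.le] at h3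
        rw [one_div]
        exact inv_lt_of_inv_lt₀ (Real.rpow_pos_of_pos hρk s) h3
      obtain ⟨i, rfl⟩ : ∃ i, k = i + 1 := ⟨k - 1, by omega⟩
      have hwi : w a (i + 1) = (w a i ++ v i (a i)) ++ [2] := by rw [hw, List.append_assoc]
      have hmem : ∀ d ∈ w a i ++ v i (a i), 2 ≤ d := fun d hd => by
        rcases List.mem_append.1 hd with h | h
        · exact hw2 a ha i d h
        · exact hv2 i _ (ha i) d h
      obtain ⟨h1, h2⟩ := sub_P_div_Q_cylMap hmem hu01
      rw [← hwi] at h1 h2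
      have hlen := hwlen a ha (i + 1)
      have hpos : 0 < cylLen (w a (i + 1)) := lt_of_lt_of_le hρk hlen
      rw [hxy, h1, h2, Real.inv_rpow hpos.le, Real.rpow_neg hpos.le, inv_inv,
        Real.rpow_add hpos, Real.rpow_one, abs_of_pos (mul_pos hpos hu01.1)]
      gcongr
      exact hult.trans_le (Real.rpow_le_rpow hρk.le hlen hs.le)
  · intro a b ha hb k hab hne
    obtain ⟨y, hy, hxy⟩ := hg a ha k
    obtain ⟨z, hz, hxz⟩ := hg b hb k
    rw [hxy, hxz, ← hwcongr a b k hab, cylMap_sub, abs_mul,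
      abs_of_pos (cylLen_pos (hw2 a ha k))]
    have hρk := (hρ k).1
    suffices h : ρ (k + 1) / m₀ * |(a k : ℝ) - b k| ≤
        ρ k * |cylMap (v k (a k)) y - cylMap (v k (b k)) z| by
      refine h.trans ?_
      gcongr
      exact hwlen a ha k
    by_cases h : k ∈ D
    · have h1 := separation_branch (hm k) (ha k) (hb k) hne hy hz
      have h2 : ∀ j y, cylMap (v k j) y = branch (m k + j) y := fun j y => by
        simp only [v]; rw [if_pos h]; rfl
      rw [h2, h2, (hD k h).2.2]
      calc _ ≤ ρ k * (1 / (8 * (m k : ℝ) ^ 2)) * |(a k : ℝ) - b k| := by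
            gcongr
            have := hm' k
            exact div_le_self (by positivity) (by linarith)
        _ ≤ _ := by
            rw [mul_assoc]
            gcongr
    · obtain ⟨-, h1, h2⟩ := hnD k h
      have hak := ha k
      have hbk := hb k
      rw [h1] at hak hbk
      have h3 : ∀ j, v k j = W j := fun j => by simp only [v]; rw [if_neg h]
      have h4 := separation_of_ne ((hW _ hak).1.trans (hW _ hbk).1.symm) (hWinj _ hak _ hbk hne)
        (hW _ hak).2.1 (hW _ hbk).2.1 hy hz (hW _ hak).2.2 (hW _ hbk).2.2
      have h5 : |(a k : ℝ) - b k| ≤ m₀ := by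
        have e1 : (a k : ℝ) ≤ m₀ := by exact_mod_cast hak.le
        have e2 : (b k : ℝ) ≤ m₀ := by exact_mod_cast hbk.le
        have e3 : (0 : ℝ) ≤ a k := by positivity
        have e4 : (0 : ℝ) ≤ b k := by positivity
        rw [abs_le]
        constructor <;> linarith
      rw [h3, h3, h2]
      calc ρ k * r / m₀ * |(a k : ℝ) - b k| ≤ ρ k * r / m₀ * m₀ := by gcongr
        _ = ρ k * (2 * r / 2) := by field_simp
        _ ≤ _ := by gcongr
  · intro k
    have hρk := (hρ k).1
    have hmk := hm' k
    have hρ1 := (hρ (k + 1)).1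
    rw [← Real.mul_rpow (by positivity) (by positivity)]
    by_cases h : k ∈ D
    · refine (hD k h).1.trans ?_
      rw [hρτ]
      have hpos : 0 < ρ k ^ s := Real.rpow_pos_of_pos hρk s
      apply Real.rpow_le_rpow (by positivity) _ ht.le
      rw [(hD k h).2.2]
      have h1 := hmle k h
      calc ρ k * ρ k ^ s ≤ ρ k * (3 * (m k : ℝ)⁻¹) := by gcongr; linarith
        _ ≤ ρ k * (3 * (m k : ℝ)⁻¹) / r := by
            rw [le_div_iff₀ hr0]
            exact mul_le_of_le_one_right (by positivity) hr1.le
        _ = _ := by field_simp; norm_num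
    · refine (hinv k).trans ?_
      apply Real.rpow_le_rpow (by positivity) _ ht.le
      rw [(hnD k h).2.2, (hnD k h).2.1]
      calc 24 * ρ k ≤ 24 * ρ k * m₀ := le_mul_of_one_le_right (by positivity) (by linarith)
        _ = _ := by field_simp

/-! ### Denominator sets and comparison with L(ψ) -/

/-- The last two digits merge into the single digit d_{k+1} d_k (d_k - 1) at position k. -/
theorem S_succ_subset {k : ℕ} (hk : 1 ≤ k) : S (k + 1) ⊆ S k := by
  rintro _ ⟨d, hd, rfl⟩
  refine ⟨Function.update d k (d (k + 1) * (d k * (d k - 1))), fun n => ?_, ?_⟩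
  · by_cases h : n = k
    · subst h
      rw [Function.update_self]
      have h1 := hd n
      calc 2 = 2 * (1 * 1) := rfl
        _ ≤ _ := Nat.mul_le_mul (hd _) (Nat.mul_le_mul (by omega) (by omega))
    · rw [Function.update_of_ne h]
      exact hd n
  · rw [denom, denom, Function.update_self, Finset.prod_Ico_succ_top hk]
    have : ∏ j ∈ Finset.Ico 1 k, Function.update d k (d (k + 1) * (d k * (d k - 1))) j *
        (Function.update d k (d (k + 1) * (d k * (d k - 1))) j - 1) =
        ∏ j ∈ Finset.Ico 1 k, d j * (d j - 1) := by
      refine Finset.prod_congr rfl fun j hj => ?_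
      rw [Finset.mem_Ico] at hj
      rw [Function.update_of_ne (by omega)]
    rw [this]
    ring

theorem S_anti {k n : ℕ} (hk : 1 ≤ k) (hkn : k ≤ n) : S n ⊆ S k := by
  induction n, hkn using Nat.le_induction with
  | base => exact Subset.rfl
  | succ n hkn ih => exact (S_succ_subset (hk.trans hkn)).trans ih

theorem lowerTau_le_lowerLambda (ψ : ℕ → ℝ) : lowerTau ψ ≤ lowerLambda ψ :=
  le_liminf_of_le (h := Eventually.of_forall fun _ => liminf_le_liminf_of_le inf_le_left)

theorem upperLambda_le_upperTau (ψ : ℕ → ℝ) : upperLambda ψ ≤ upperTau ψ :=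
  (liminf_le_liminf (Eventually.of_forall fun _ => limsup_le_limsup_of_le inf_le_left)).trans
    (liminf_const _).le

theorem mem_L {ψ : ℕ → ℝ} {x : ℝ} : x ∈ L ψ ↔ x ∈ Ioc (0 : ℝ) 1 ∧
    ∃ᶠ n in atTop, |x - P n x / (Q n x : ℝ)| < ψ (Q n x) / (Q n x : ℝ) := by
  rw [L, mem_limsup_iff_frequently_mem]
  constructor
  · intro h
    obtain ⟨n, hn⟩ := h.exists
    exact ⟨hn.1, h.mono fun n hn => hn.2⟩
  · rintro ⟨hx, h⟩
    exact h.mono fun n hn => ⟨hx, hn⟩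

/-- For n ≥ k the denominator Q_n lies in S_n ⊆ S_k, and Q_n ≥ 2^n tends to infinity. One good level
k thus controls all large n. -/
theorem eventually_Q {p : ℕ → Prop} {k : ℕ} (h : ∀ᶠ q in atTop ⊓ 𝓟 (S k), p q) (hk : 1 ≤ k) {x : ℝ}
    (hx : x ∈ Ioc (0 : ℝ) 1) : ∀ᶠ n in atTop, 2 ≤ Q n x ∧ p (Q n x) := by
  rw [eventually_inf_principal, eventually_atTop] at h
  obtain ⟨N, hN⟩ := h
  filter_upwards [eventually_ge_atTop (max k N)] with n hn
  have hkn : k ≤ n := (le_max_left _ _).trans hn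
  have h2 := two_pow_le_denom (two_le_digit hx) (hk.trans hkn)
  have hnN : N ≤ n := (le_max_right _ _).trans hn
  refine ⟨le_trans (le_self_pow₀ (by norm_num) (by omega)) h2, hN _ ?_ ?_⟩
  · exact hnN.trans (Nat.lt_two_pow_self.le.trans h2)
  · exact S_anti hk hkn ⟨digit x, two_le_digit hx, rfl⟩

theorem lt_rpow_of_lt_ratio {ψ : ℕ → ℝ} {q : ℕ} (hψ : 0 < ψ q) (hq : 2 ≤ q) {s : ℝ} (hs : 0 ≤ s)
    (h : ENNReal.ofReal s < ratio ψ q) : ψ q < (q : ℝ) ^ (-s) := by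
  have hq' : (2 : ℝ) ≤ q := by exact_mod_cast hq
  have hlog : 0 < Real.log q := Real.log_pos (by linarith)
  have h1 := (ENNReal.ofReal_lt_ofReal_iff_of_nonneg hs).1 h
  rw [lt_div_iff₀ hlog] at h1
  rw [← Real.log_lt_log_iff hψ (by positivity), Real.log_rpow (by linarith)]
  linarith

theorem rpow_lt_of_ratio_lt {ψ : ℕ → ℝ} {q : ℕ} (hψ : 0 < ψ q) (hq : 2 ≤ q) {s : ℝ}
    (hs : 0 < s) (h : ratio ψ q < ENNReal.ofReal s) : (q : ℝ) ^ (-s) < ψ q := by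
  have hq' : (2 : ℝ) ≤ q := by exact_mod_cast hq
  have hlog : 0 < Real.log q := Real.log_pos (by linarith)
  have h1 := (ENNReal.ofReal_lt_ofReal_iff hs).1 h
  rw [div_lt_iff₀ hlog] at h1
  rw [← Real.log_lt_log_iff (by positivity) hψ, Real.log_rpow (by linarith)]
  linarith

theorem rpow_neg_div_self {q : ℕ} (hq : 2 ≤ q) (s : ℝ) :
    (q : ℝ) ^ (-s) / q = (q : ℝ) ^ (-(1 + s)) := by
  have hq' : (0 : ℝ) < q := by exact_mod_cast (by omega : 0 < q)
  rw [neg_add, add_comm, Real.rpow_add hq', Real.rpow_neg_one, div_eq_mul_inv]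

theorem L_subset_wellApprox {ψ : ℕ → ℝ} (hψ : ∀ q : ℕ, 1 ≤ q → ψ q ∈ Ioc (0 : ℝ) 1) {s : ℝ} (hs : 0 ≤ s)
    (h : ENNReal.ofReal s < lowerLambda ψ) : L ψ ⊆ wellApprox s := by
  obtain ⟨k, hk, hk1⟩ := ((eventually_lt_of_lt_liminf h).and (eventually_ge_atTop 1)).exists
  intro x hx
  rw [mem_L] at hx
  refine ⟨hx.1, (hx.2.and_eventually
    (eventually_Q (eventually_lt_of_lt_liminf hk) hk1 hx.1)).mono ?_⟩
  rintro n ⟨h1, h2, h3⟩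
  rw [← rpow_neg_div_self h2]
  have := lt_rpow_of_lt_ratio (hψ _ (by omega)).1 h2 hs h3
  refine h1.trans_le ?_
  gcongr

theorem wellApprox_subset_L {ψ : ℕ → ℝ} (hψ : ∀ q : ℕ, 1 ≤ q → ψ q ∈ Ioc (0 : ℝ) 1) {s : ℝ} (hs : 0 < s)
    (h : upperLambda ψ < ENNReal.ofReal s) : wellApprox s ⊆ L ψ := by
  obtain ⟨k, hk, hk1⟩ :=
    ((frequently_lt_of_liminf_lt (h := h)).and_eventually (eventually_ge_atTop 1)).exists
  rintro x ⟨hx, hfr⟩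
  rw [mem_L]
  refine ⟨hx, (hfr.and_eventually (eventually_Q (eventually_lt_of_limsup_lt hk) hk1 hx)).mono ?_⟩
  rintro n ⟨h1, h2, h3⟩
  rw [← rpow_neg_div_self h2] at h1
  have := rpow_lt_of_ratio_lt (hψ _ (by omega)).1 h2 hs h3
  refine h1.trans_le ?_
  gcongr

theorem dimH_L_le {ψ : ℕ → ℝ} (hψ : ∀ q : ℕ, 1 ≤ q → ψ q ∈ Ioc (0 : ℝ) 1) :
    dimH (L ψ) ≤ 1 / (1 + lowerLambda ψ) := by
  -- In inverted form it suffices to test finite c < `lowerLambda ψ`, which also covers an infinite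
  -- order.
  rw [one_div, ENNReal.le_inv_iff_le_inv]
  have h1 : dimH (L ψ) ≤ 1 := (dimH_mono (subset_univ _)).trans Real.dimH_univ.le
  have h1' : 1 ≤ (dimH (L ψ))⁻¹ := ENNReal.one_le_inv.2 h1
  have key : ∀ c : ℝ≥0∞, c < lowerLambda ψ → c ≤ (dimH (L ψ))⁻¹ - 1 := by
    intro c hc
    lift c to NNReal using hc.ne_top
    have hc' : ENNReal.ofReal (c : ℝ) < lowerLambda ψ := by simpa using hc
    have h2 : dimH (L ψ) ≤ ENNReal.ofReal (1 / (1 + c)) := by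
      refine (dimH_mono (L_subset_wellApprox hψ c.2 hc')).trans ?_
      have hpos : (0 : ℝ) < 1 + c := by positivity
      refine le_of_forall_gt_imp_ge_of_dense fun b hb => ?_
      by_cases hbt : b = ∞
      · rw [hbt]; exact le_top
      lift b to NNReal using hbt
      have hb' : 1 / (1 + c : ℝ) < b := by
        rw [← ENNReal.ofReal_coe_nnreal] at hb
        exact (ENNReal.ofReal_lt_ofReal_iff_of_nonneg (by positivity)).1 hb
      rw [div_lt_iff₀ hpos, mul_comm] at hb'
      simpa using dimH_wellApprox_le c.2 b.2 hb'
    refine ENNReal.le_sub_of_add_le_left (by simp) ?_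
    rw [ENNReal.le_inv_iff_le_inv]
    refine h2.trans (le_of_eq ?_)
    rw [one_div, ENNReal.ofReal_inv_of_pos (by positivity), ENNReal.ofReal_add zero_le_one c.coe_nonneg,
      ENNReal.ofReal_one, ENNReal.ofReal_coe_nnreal]
  calc 1 + lowerLambda ψ ≤ 1 + ((dimH (L ψ))⁻¹ - 1) := by
        gcongr
        exact le_of_forall_lt_imp_le_of_dense key
    _ = (dimH (L ψ))⁻¹ := add_tsub_cancel_of_le h1'

theorem le_dimH_L {ψ : ℕ → ℝ} (hψ : ∀ q : ℕ, 1 ≤ q → ψ q ∈ Ioc (0 : ℝ) 1) :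
    1 / (1 + upperLambda ψ) ≤ dimH (L ψ) := by
  by_cases htop : upperLambda ψ = ∞
  · simp [htop]
  obtain ⟨l, hl⟩ : ∃ l : NNReal, (l : ℝ≥0∞) = upperLambda ψ := ⟨_, ENNReal.coe_toNNReal htop⟩
  refine le_of_forall_lt_imp_le_of_dense fun c hc => ?_
  by_cases hc0 : c = 0
  · rw [hc0]; exact zero_le
  lift c to NNReal using hc.ne_top
  have hc0' : (0 : ℝ) < c := by
    have : c ≠ 0 := by simpa using hc0
    exact_mod_cast pos_iff_ne_zero.2 this
  have h1 : (1 + l : ℝ) * c < 1 := by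
    rw [← hl, one_div, ENNReal.lt_inv_iff_lt_inv] at hc
    have h2 : (1 + l : NNReal) < c⁻¹ := by
      rw [← ENNReal.coe_inv (by simpa using hc0)] at hc
      exact_mod_cast hc
    have h3 : (1 + l : ℝ) < (c : ℝ)⁻¹ := by exact_mod_cast h2
    calc (1 + l : ℝ) * c < (c : ℝ)⁻¹ * c := by gcongr
      _ = 1 := inv_mul_cancel₀ hc0'.ne'
  obtain ⟨s, hs1, hs2⟩ : ∃ s : ℝ, (l : ℝ) < s ∧ s < 1 / c - 1 := by
    apply exists_between
    rw [lt_sub_iff_add_lt, lt_div_iff₀ hc0']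
    linarith
  have hs0 : 0 < s := lt_of_le_of_lt l.2 hs1
  rw [lt_sub_iff_add_lt, lt_div_iff₀ hc0', add_comm] at hs2
  have h4 := le_dimH_wellApprox hs0 hc0' hs2
  rw [ENNReal.ofReal_coe_nnreal] at h4
  refine h4.trans (dimH_mono (wellApprox_subset_L hψ hs0 ?_))
  rw [← hl, ← ENNReal.ofReal_coe_nnreal]
  exact (ENNReal.ofReal_lt_ofReal_iff hs0).2 hs1

end Luroth

theorem theorem4 (ψ : ℕ → ℝ) (hψ : ∀ q : ℕ, 1 ≤ q → ψ q ∈ Set.Ioc (0 : ℝ) 1) :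
    (1 / (1 + Luroth.upperLambda ψ) ≤ dimH (Luroth.L ψ) ∧
      dimH (Luroth.L ψ) ≤ 1 / (1 + Luroth.lowerLambda ψ)) ∧
    Luroth.lowerTau ψ ≤ Luroth.lowerLambda ψ ∧
    Luroth.upperLambda ψ ≤ Luroth.upperTau ψ :=
  ⟨⟨Luroth.le_dimH_L hψ, Luroth.dimH_L_le hψ⟩, Luroth.lowerTau_le_lowerLambda ψ,
    Luroth.upperLambda_le_upperTau ψ⟩
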